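/- All logarithms are to base $2$. A capacitated graph $G=(V,E,c)$ is a finite undirected graph with edge capacities $c(e)\ge 1$; $T\subseteq V$ is its set of terminals. A demand $\mathcal D$ on $T$ assigns a real number $\mathcal D_{t,t'}\ge 0$ to every unordered pair of distinct terminals, not all zero. A flow assigns a number $f_P\ge 0$ to every path $P$ between two terminals; it routes $\mathcal D$ if for all distinct $t,t'\in T$ the values of $f$ on the $t$-$t'$ paths sum to $\mathcal D_{t,t'}$. The congestion of a flow is $\max_{e\in E}\frac1{c(e)}\sum_{P\ni e}f_P$, and $\mathrm{cong}_G(\mathcal D)$ is the minimum congestion of a flow that routes $\mathcal D$ in $G$ ($\infty$ if there is none). A partition $\mathcal F$ of $V$ is valid if distinct terminals lie in distinct clusters of $\mathcal F$. The contracted graph $H$ of $G$ with respect to $\mathcal F$ has the clusters as vertices; distinct clusters $A,B$ are adjacent if $G$ has an edge between them, and the capacity of $(A,B)$ is the total capacity of the edges of $G$ between $A$ and $B$. In $H$, each terminal is identified with the cluster that contains it. **Theorem.** Let $0<\varepsilon<1$, $\alpha=\frac{\log 5}{\log 5+1-\varepsilon}$ and $\beta=\frac{\log 5-0.5\varepsilon}{\log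 5+1-\varepsilon}$. There is a constant $c_0>0$ such that for every large enough integer $n$ there exist a connected $n$-vertex capacitated graph $G=(V,E,c)$ and a set $T\subseteq V$ of $\left\lfloor n/2^{(\log n)^{\alpha}}\right\rfloor$ terminals with the following property. For every valid partition $\mathcal F$ of $V$ of size $|\mathcal F|=O\!\left(n/2^{(\log n)^{\beta}}\right)$ there is a demand $\mathcal D$ on $T$ with $$\mathrm{cong}_G(\mathcal D)\ \ge\ c_0\,(\log n)^{1-\alpha}\qquad\text{and}\qquad \mathrm{cong}_H(\mathcal D)\le 3,$$ where $H$ is the contracted graph of $G$ with respect to $\mathcal F$. Here the $O(\cdot)$ means: for every constant $C$ there is $N(C)$ (depending only on $\varepsilon$ and $C$) such that the property holds for all $n\ge N(C)$ and all valid $\mathcal F$ with $|\mathcal F|\le C\,n/2^{(\log n)^{\beta}}$; neither the graphs $G$ and sets $T$ (one pair for each $n$) nor the constant $c_0$ depend on $C$. -/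

import Mathlib

open scoped NNReal ENNReal

noncomputable section

/-- A finite undirected graph `G = (V, E, c)` with edge capacities `c(e) ≥ 1`.
(Values of `cap` outside the edge set are never used.) -/
structure CapGraph (V : Type*) where
  graph : SimpleGraph V
  cap : Sym2 V → ℝ≥0
  one_le_cap : ∀ e ∈ graph.edgeSet, 1 ≤ cap e

/-- A demand on a set `ι` of terminals: a nonnegative number for every unordered pair of distinct
terminals (encoded as a symmetric function vanishing on the diagonal), not all of them zero. -/
structure Demand (ι : Type*) where
  val : ι → ι → ℝ≥0
  symm : ∀ t t', val t t' = val t' t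
  diag : ∀ t, val t t = 0
  ne_zero : ∃ t t', val t t' ≠ 0

namespace CapGraph

variable {V : Type*} [Fintype V] [DecidableEq V]

open Classical in
/-- The collection of (simple) `u`-`v` paths of `G`. Edges being undirected, a path is recorded as
its set of edges, so that the `u`-`v` paths and the `v`-`u` paths are the same objects. -/
def paths (G : CapGraph V) (u v : V) : Finset (Finset (Sym2 V)) :=
  Finset.univ.filter fun P => ∃ p : G.graph.Walk u v, p.IsPath ∧ p.edges.toFinset = P

variable {ι : Type*}

open Classical in
/-- The collection of all paths of `G` between terminals; the terminal `t : ι` is located at the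
vertex `τ t`. -/
def terminalPaths (G : CapGraph V) (τ : ι → V) : Finset (Finset (Sym2 V)) :=
  Finset.univ.filter fun P => ∃ t t', P ∈ G.paths (τ t) (τ t')

/-- The flow `f` (a nonnegative amount for each path) routes the demand `D`. -/
def Routes (G : CapGraph V) (τ : ι → V) (f : Finset (Sym2 V) → ℝ≥0) (D : Demand ι) : Prop :=
  ∀ t t', t ≠ t' → ∑ P ∈ G.paths (τ t) (τ t'), f P = D.val t t'

/-- The congestion of a flow: the maximum over the edges of `G` of the amount of flow sent through
the edge divided by its capacity (`0` if there are no edges). -/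
def flowCong (G : CapGraph V) (τ : ι → V) (f : Finset (Sym2 V) → ℝ≥0) : ℝ≥0∞ :=
  ⨆ e ∈ G.graph.edgeSet,
    (((∑ P ∈ (G.terminalPaths τ).filter (fun P => e ∈ P), f P) / G.cap e : ℝ≥0) : ℝ≥0∞)

/-- The congestion of a demand: the least congestion of a flow that routes it
(`∞` if no flow routes it). -/
def cong (G : CapGraph V) (τ : ι → V) (D : Demand ι) : ℝ≥0∞ :=
  ⨅ (f : Finset (Sym2 V) → ℝ≥0) (_ : G.Routes τ f D), G.flowCong τ f

end CapGraph

section Contraction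

variable {V : Type*} [Fintype V] [DecidableEq V]

/-- The cluster `F(u)` of the partition `F` that contains the vertex `u`. -/
def clusterOf (F : Finpartition (Finset.univ : Finset V)) (u : V) : F.parts :=
  ⟨F.part u, F.part_mem.2 (Finset.mem_univ u)⟩

/-- A partition is valid for the terminal set `T` if distinct terminals lie in distinct clusters. -/
def ValidPartition (T : Finset V) (F : Finpartition (Finset.univ : Finset V)) : Prop :=
  ∀ t ∈ T, ∀ t' ∈ T, clusterOf F t = clusterOf F t' → t = t'

open Classical in
/-- The contracted graph `H` of `G` with respect to the partition `F`: its vertices are the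
clusters, two distinct clusters are adjacent if some edge of `G` joins them, and the capacity of
`(A, B)` is the total capacity of all edges of `G` between `A` and `B`. -/
def CapGraph.contract (G : CapGraph V) (F : Finpartition (Finset.univ : Finset V)) :
    CapGraph F.parts where
  graph :=
    { Adj := fun A B => A ≠ B ∧ ∃ u v, clusterOf F u = A ∧ clusterOf F v = B ∧ G.graph.Adj u v
      symm := ⟨fun _ _ h => ⟨h.1.symm, by
        obtain ⟨_, u, v, hu, hv, h⟩ := h
        exact ⟨v, u, hv, hu, h.symm⟩⟩⟩
      loopless := ⟨fun _ h => h.1 rfl⟩ }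
  cap := fun e' => ∑ e ∈ G.graph.edgeFinset.filter (fun e => e.map (clusterOf F) = e'), G.cap e
  one_le_cap := by
    intro e' he'
    induction e' with
    | _ A B =>
      obtain ⟨_, u, v, rfl, rfl, h⟩ := he'
      have hmem : s(u, v) ∈ G.graph.edgeFinset.filter
          (fun e => e.map (clusterOf F) = s(clusterOf F u, clusterOf F v)) := by
        simp [h]
      exact (G.one_le_cap s(u, v) h).trans
        (Finset.single_le_sum (f := G.cap) (fun _ _ => zero_le) hmem)

end Contraction

end

/-!
Take a graph `G` of large girth in which almost every vertex meets one edge of each of many colours,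
and enough terminals that almost every vertex has one nearby; the capacities leave room for the
paths to these terminals. A demand that `H` routes with congestion `3`, but whose total flow has to
travel far in `G`, has large congestion in `G`. By linear programming duality, if there is no such
demand, then `H` has edge lengths of small total volume for which terminals are as far apart in `H`
as they are in `G`. Pulled back to `G`, where the edges inside a cluster get length `0`, these
lengths almost never bring two vertices much closer than their distance in `G`.

There are few clusters, so most vertices can be permuted within their clusters in such a way that
they move far in `G`. Alternate such a jump, which is free in `H`, with an edge of random colour.
The volume bound makes the walk cheap in `H` on average, and for suitable colours it never returns
along the path it jumped over. Locally `G` is a tree, so every jump takes the walk further away from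
its starting point in `G`, and eventually its ends are closer in `H` than the lengths allow.
-/

section LinearAlternatives

open Matrix

variable {m n : Type*}

theorem map_nonneg_of_forall_neg (φ : (m → ℝ) →ₗ[ℝ] ℝ)
    (hφ : ∀ x : m → ℝ, (∀ i, x i < 0) → φ x < 0) {x : m → ℝ} (hx : 0 ≤ x) : 0 ≤ φ x := by
  by_contra! hneg
  have hone : 0 < φ 1 := by simpa using hφ (-1) (by simp)
  have hc : 0 < φ 1 / φ (-x) := div_pos hone (by rwa [map_neg, neg_pos])
  have := hφ (-1 + (φ 1 / φ (-x)) • -x) fun i => by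
    have := mul_nonneg hc.le (hx i)
    simp only [Pi.add_apply, Pi.neg_apply, Pi.one_apply, Pi.smul_apply, smul_eq_mul]
    linarith
  rw [map_add, map_smul, smul_eq_mul, div_mul_cancel₀ _ (by simpa using hneg.ne), map_neg] at this
  linarith

-- Ville's theorem of the alternative.
theorem exists_mulVec_neg_or_exists_vecMul_nonneg [Fintype m] [Fintype n] (M : Matrix m n ℝ) :
    (∃ f, 0 ≤ f ∧ ∀ i, (M *ᵥ f) i < 0) ∨ ∃ y, 0 ≤ y ∧ y ≠ 0 ∧ 0 ≤ y ᵥ* M := by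
  classical
  let N : Set (m → ℝ) := Set.univ.pi fun _ => Set.Iio 0
  let K : Set (m → ℝ) := M.mulVecLin '' Set.Ici 0
  by_cases hNK : Disjoint N K
  · right
    obtain ⟨φ, s, hφN, hφK⟩ := geometric_hahn_banach_open
      (convex_pi fun _ _ => convex_Iio 0) (isOpen_set_pi Set.finite_univ fun _ _ => isOpen_Iio)
      ((convex_Ici 0).linear_image M.mulVecLin) hNK
    have hs : s ≤ 0 := by simpa using hφK 0 ⟨0, Set.self_mem_Ici, by simp⟩
    have hneg : ∀ x : m → ℝ, (∀ i, x i < 0) → φ x < 0 := fun x hx =>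
      (hφN x fun i _ => hx i).trans_le hs
    have hK : ∀ f, 0 ≤ f → 0 ≤ φ (M *ᵥ f) := by
      intro f hf
      by_contra! hlt
      have hmul : 0 ≤ (s - 1) / φ (M *ᵥ f) := div_nonneg_of_nonpos (by linarith) hlt.le
      have := hφK _ ⟨((s - 1) / φ (M *ᵥ f)) • f, smul_nonneg hmul hf, rfl⟩
      rw [mulVecLin_apply, mulVec_smul, map_smul, smul_eq_mul, div_mul_cancel₀ _ hlt.ne] at this
      linarith
    have hφ : ∀ x, φ x = (fun i => φ (Pi.single i 1)) ⬝ᵥ x := fun x => by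
      conv_lhs => rw [pi_eq_sum_univ' x]
      simp [dotProduct, mul_comm]
    have hone : 0 < φ 1 := by simpa using hneg (-1) (by simp)
    refine ⟨fun i => φ (Pi.single i 1), fun i => ?_, fun h0 => ?_, fun j => ?_⟩
    · exact map_nonneg_of_forall_neg φ.toLinearMap hneg (Pi.single_nonneg.2 zero_le_one)
    · rw [hφ, h0, zero_dotProduct] at hone
      exact hone.false
    · have := hK (Pi.single j 1) (Pi.single_nonneg.2 zero_le_one)
      rwa [hφ, dotProduct_mulVec, dotProduct_single_one] at this
  · left
    obtain ⟨_, hx, f, hf, rfl⟩ := Set.not_disjoint_iff.1 hNK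
    exact ⟨f, hf, fun i => hx i trivial⟩

-- The coefficient `s` may vanish: then `g` is a ray along which `w ⬝ᵥ ·` is unbounded.
theorem exists_packing_of_homogeneous [Fintype n] {A : Matrix m n ℝ} {b : m → ℝ} (hb : 0 ≤ b)
    {w : n → ℝ} {v : ℝ} {g : n → ℝ} (hg : 0 ≤ g) {s : ℝ} (hs : 0 ≤ s) (hcap : A *ᵥ g ≤ s • b)
    (hval : s * v < w ⬝ᵥ g) : ∃ f, 0 ≤ f ∧ A *ᵥ f ≤ b ∧ v < w ⬝ᵥ f := by
  obtain ⟨c, hc, hcs, hcv⟩ : ∃ c, 0 ≤ c ∧ c * s ≤ 1 ∧ v < c * (w ⬝ᵥ g) := by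
    rcases hs.eq_or_lt with rfl | hs
    · rw [zero_mul] at hval
      refine ⟨(|v| + 1) / (w ⬝ᵥ g), by positivity, by simp, ?_⟩
      rw [div_mul_cancel₀ _ hval.ne']
      linarith [le_abs_self v]
    · refine ⟨s⁻¹, by positivity, (inv_mul_cancel₀ hs.ne').le, ?_⟩
      rwa [← div_eq_inv_mul, lt_div_iff₀ hs, mul_comm]
  refine ⟨c • g, smul_nonneg hc hg, ?_, by rwa [dotProduct_smul, smul_eq_mul]⟩
  calc A *ᵥ (c • g) = c • (A *ᵥ g) := mulVec_smul ..
    _ ≤ c • s • b := smul_le_smul_of_nonneg_left hcap hc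
    _ = (c * s) • b := smul_smul ..
    _ ≤ b := fun i => mul_le_of_le_one_left (hb i) hcs

theorem exists_covering_of_homogeneous [Fintype m] {A : Matrix m n ℝ} {b : m → ℝ}
    (hb : ∀ i, 0 < b i) {w : n → ℝ} {v : ℝ} {y : m → ℝ} (hy : 0 ≤ y) {z : ℝ} (hz : 0 ≤ z)
    (hne : y ≠ 0 ∨ z ≠ 0) (hobj : b ⬝ᵥ y ≤ z * v) (hcol : z • w ≤ y ᵥ* A) :
    ∃ y, 0 ≤ y ∧ b ⬝ᵥ y ≤ v ∧ w ≤ y ᵥ* A := by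
  have hzpos : 0 < z := by
    refine hz.lt_of_ne' fun hz0 => hne.elim (fun hy0 => hy0 ?_) (fun hz' => hz' hz0)
    have hsum : b ⬝ᵥ y = 0 := le_antisymm (by simpa [hz0] using hobj)
      (dotProduct_nonneg_of_nonneg (fun i => (hb i).le) hy)
    have hterm := (Finset.sum_eq_zero_iff_of_nonneg fun i _ => mul_nonneg (hb i).le (hy i)).1 hsum
    ext i
    exact (mul_eq_zero.1 (hterm i (Finset.mem_univ i))).resolve_left (hb i).ne'
  refine ⟨z⁻¹ • y, smul_nonneg (inv_nonneg.2 hz) hy, ?_, fun j => ?_⟩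
  · rwa [dotProduct_smul, smul_eq_mul, ← div_eq_inv_mul, div_le_iff₀' hzpos]
  · rw [smul_vecMul, Pi.smul_apply, smul_eq_mul, ← div_eq_inv_mul, le_div_iff₀' hzpos]
    exact hcol j

-- Strong duality for packing programs, by Ville's theorem for the homogenized pair of programs.
theorem exists_packing_or_exists_covering [Fintype m] [Fintype n] (A : Matrix m n ℝ) {b : m → ℝ}
    (hb : ∀ i, 0 < b i) (w : n → ℝ) (v : ℝ) :
    (∃ f, 0 ≤ f ∧ A *ᵥ f ≤ b ∧ v < w ⬝ᵥ f) ∨ ∃ y, 0 ≤ y ∧ b ⬝ᵥ y ≤ v ∧ w ≤ y ᵥ* A := by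
  let M := fromBlocks A (replicateCol Unit (-b)) (replicateRow Unit (-w)) (of fun _ _ => v)
  obtain ⟨f, hf, hneg⟩ | ⟨y, hy, hy0, hnn⟩ := exists_mulVec_neg_or_exists_vecMul_nonneg M
  · obtain ⟨g, s, rfl⟩ : ∃ g s, f = Sum.elim g s := ⟨f ∘ Sum.inl, f ∘ Sum.inr, by simp⟩
    refine .inl (exists_packing_of_homogeneous (fun i => (hb i).le) (fun j => hf (.inl j))
      (hf (.inr ())) ?_ ?_)
    · intro i
      simpa [M, fromBlocks_mulVec, mulVec, dotProduct, mul_comm] using (hneg (.inl i)).le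
    · simpa [M, fromBlocks_mulVec, mulVec, dotProduct, mul_comm] using hneg (.inr ())
  · obtain ⟨y, z, rfl⟩ : ∃ u z, y = Sum.elim u z := ⟨y ∘ Sum.inl, y ∘ Sum.inr, by simp⟩
    refine .inr (exists_covering_of_homogeneous hb (fun i => hy (.inl i)) (hy (.inr ()))
      ?_ ?_ fun j => ?_)
    · contrapose! hy0
      ext (i | _)
      · exact congrFun hy0.1 i
      · exact hy0.2
    · simpa [M, vecMul_fromBlocks, vecMul, dotProduct, mul_comm] using hnn (.inr ())
    · simpa [M, vecMul_fromBlocks, vecMul, dotProduct] using hnn (.inl j)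

end LinearAlternatives

namespace CapGraph

variable {V ι : Type*} [Fintype V] [DecidableEq V] {G : CapGraph V} {τ : ι → V}

theorem mem_paths {u v : V} {P : Finset (Sym2 V)} :
    P ∈ G.paths u v ↔ ∃ p : G.graph.Walk u v, p.IsPath ∧ p.edges.toFinset = P := by
  simp only [paths, Finset.mem_filter_univ]

theorem paths_comm (u v : V) : G.paths u v = G.paths v u := by
  have hsub : ∀ u v, G.paths u v ⊆ G.paths v u := fun u v P hP => by
    obtain ⟨p, hp, rfl⟩ := mem_paths.1 hP
    exact mem_paths.2 ⟨p.reverse, hp.reverse, by ext; simp⟩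
  exact (hsub u v).antisymm (hsub v u)

theorem mem_terminalPaths {P : Finset (Sym2 V)} :
    P ∈ G.terminalPaths τ ↔ ∃ t t', P ∈ G.paths (τ t) (τ t') := by
  simp only [terminalPaths, Finset.mem_filter_univ]

open Classical in
theorem subset_edgeFinset_of_mem_paths {u v : V} {P : Finset (Sym2 V)} (hP : P ∈ G.paths u v) :
    P ⊆ G.graph.edgeFinset := by
  obtain ⟨p, -, rfl⟩ := mem_paths.1 hP
  exact fun e he => SimpleGraph.mem_edgeFinset.2 (p.edges_subset_edgeSet (List.mem_toFinset.1 he))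

theorem dist_le_card_of_mem_paths {u v : V} {P : Finset (Sym2 V)} (hP : P ∈ G.paths u v) :
    G.graph.dist u v ≤ P.card := by
  obtain ⟨p, hp, rfl⟩ := mem_paths.1 hP
  rw [List.toFinset_card_of_nodup hp.isTrail.edges_nodup, p.length_edges]
  exact SimpleGraph.dist_le p

-- The endpoints of a path are the vertices that meet an odd number of its edges.
theorem endpoints_of_mem_paths {u v u' v' : V} {P : Finset (Sym2 V)} (huv : u ≠ v)
    (h : P ∈ G.paths u v) (h' : P ∈ G.paths u' v') : (u' = u ∧ v' = v) ∨ (u' = v ∧ v' = u) := by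
  obtain ⟨p, hp, rfl⟩ := mem_paths.1 h
  obtain ⟨q, hq, hqp⟩ := mem_paths.1 h'
  have hperm : p.edges.Perm q.edges := by
    refine (List.perm_ext_iff_of_nodup hp.isTrail.edges_nodup hq.isTrail.edges_nodup).2 fun e => ?_
    rw [← List.mem_toFinset, ← List.mem_toFinset, hqp]
  have hne : u' ≠ v' := by
    rintro rfl
    obtain rfl : q = .nil := by simpa using hq
    have : p.length = 0 := by rw [← p.length_edges, hperm.length_eq]; rfl
    exact huv (p.eq_of_length_eq_zero this)
  have hend : ∀ x, (x ≠ u ∧ x ≠ v) ↔ (x ≠ u' ∧ x ≠ v') := by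
    intro x
    have h1 := hp.isTrail.even_countP_edges_iff x
    have h2 := hq.isTrail.even_countP_edges_iff x
    rw [hperm.countP_eq] at h1
    simp only [ne_eq, huv, hne, not_false_eq_true, true_imp_iff] at h1 h2
    exact h1.symm.trans h2
  grind [hend u, hend v, hend u', hend v']

open Classical in
theorem card_terminal_pairs_le_two [Fintype ι] (hτ : Function.Injective τ)
    (P : Finset (Sym2 V)) :
    (Finset.univ.filter fun x : ι × ι => x.1 ≠ x.2 ∧ P ∈ G.paths (τ x.1) (τ x.2)).card ≤ 2 := by
  rcases Finset.eq_empty_or_nonempty (Finset.univ.filter fun x : ι × ι =>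
    x.1 ≠ x.2 ∧ P ∈ G.paths (τ x.1) (τ x.2)) with h0 | ⟨⟨a, b⟩, hab⟩
  · simp [h0]
  · rw [Finset.mem_filter_univ] at hab
    refine (Finset.card_le_card (t := {(a, b), (b, a)}) fun x hx => ?_).trans Finset.card_le_two
    rw [Finset.mem_filter_univ] at hx
    obtain ⟨h1, h2⟩ | ⟨h1, h2⟩ := endpoints_of_mem_paths (hτ.ne hab.1) hab.2 hx.2
    · simp [Prod.ext_iff, hτ h1, hτ h2]
    · simp [Prod.ext_iff, hτ h1, hτ h2]

theorem flowCong_le_iff {f : Finset (Sym2 V) → ℝ≥0} {κ : ℝ≥0} :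
    G.flowCong τ f ≤ κ ↔ ∀ e ∈ G.graph.edgeSet,
      ∑ P ∈ (G.terminalPaths τ).filter (fun P => e ∈ P), f P ≤ κ * G.cap e := by
  simp only [flowCong, iSup₂_le_iff, ENNReal.coe_le_coe]
  exact forall₂_congr fun e he => div_le_iff₀ (zero_lt_one.trans_le (G.one_le_cap e he))

/-- The constraint of the dual of the multicommodity flow program: for the edge lengths `ℓ`,
distinct terminals `t` and `t'` are at distance at least `δ t t'`. -/
def LengthsDominate (G : CapGraph V) (τ : ι → V) (ℓ : Sym2 V → ℝ) (δ : ι → ι → ℝ) : Prop :=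
  ∀ t t', t ≠ t' → ∀ P ∈ G.paths (τ t) (τ t'), δ t t' ≤ ∑ e ∈ P, ℓ e

theorem lengthsDominate_one_dist :
    G.LengthsDominate τ 1 fun t t' => G.graph.dist (τ t) (τ t') := fun t t' _ P hP => by
  simpa using dist_le_card_of_mem_paths hP

theorem exists_demand_of_flow [Fintype ι] (f : Finset (Sym2 V) → ℝ≥0) {δ : ι → ι → ℝ}
    (hδ : ∀ t, δ t t = 0)
    (hne : ∑ t, ∑ t', ((∑ P ∈ G.paths (τ t) (τ t'), f P : ℝ≥0) : ℝ) * δ t t' ≠ 0) :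
    ∃ D : Demand ι, G.Routes τ f D ∧ ∑ t, ∑ t', (D.val t t' : ℝ) * δ t t' =
      ∑ t, ∑ t', ((∑ P ∈ G.paths (τ t) (τ t'), f P : ℝ≥0) : ℝ) * δ t t' := by
  classical
  let d : ι → ι → ℝ≥0 := fun t t' => if t = t' then 0 else ∑ P ∈ G.paths (τ t) (τ t'), f P
  have hd : ∀ t t', t ≠ t' → d t t' = ∑ P ∈ G.paths (τ t) (τ t'), f P := fun t t' h => if_neg h
  have hsum : ∑ t, ∑ t', (d t t' : ℝ) * δ t t' =
      ∑ t, ∑ t', ((∑ P ∈ G.paths (τ t) (τ t'), f P : ℝ≥0) : ℝ) * δ t t' := by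
    refine Finset.sum_congr rfl fun t _ => Finset.sum_congr rfl fun t' _ => ?_
    rcases eq_or_ne t t' with rfl | h
    · simp [hδ]
    · rw [hd t t' h]
  have hd0 : ∃ t t', d t t' ≠ 0 := by
    by_contra! hall
    exact hne (by rw [← hsum]; simp [hall])
  have hsymm : ∀ t t', d t t' = d t' t := fun t t' => by
    simp only [d, eq_comm (a := t), paths_comm (τ t)]
  exact ⟨⟨d, hsymm, fun t => if_pos rfl, hd0⟩, fun t t' h => (hd t t' h).symm, hsum⟩

open Classical in
theorem exists_flow_or_exists_lengths (G : CapGraph V) (τ : ι → V) (w : Finset (Sym2 V) → ℝ)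
    {κ : ℝ≥0} (hκ : 0 < κ) (v : ℝ) :
    (∃ f : Finset (Sym2 V) → ℝ≥0, G.flowCong τ f ≤ κ ∧ v < ∑ P ∈ G.terminalPaths τ, w P * f P) ∨
    ∃ ℓ : Sym2 V → ℝ, 0 ≤ ℓ ∧ κ * ∑ e ∈ G.graph.edgeFinset, (G.cap e : ℝ) * ℓ e ≤ v ∧
      ∀ P ∈ G.terminalPaths τ, w P ≤ ∑ e ∈ P, ℓ e := by
  let A : Matrix (Sym2 V) (Finset (Sym2 V)) ℝ :=
    .of fun e P => if e ∈ P ∧ P ∈ G.terminalPaths τ then 1 else 0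
  let b : Sym2 V → ℝ := fun e => if e ∈ G.graph.edgeSet then κ * G.cap e else 1
  have hb : ∀ e, 0 < b e := fun e => by
    by_cases he : e ∈ G.graph.edgeSet
    · have : 0 < G.cap e := zero_lt_one.trans_le (G.one_le_cap e he)
      simp only [b, he, if_true]
      positivity
    · simp [b, he]
  obtain ⟨f, hf, hcap, hval⟩ | ⟨ℓ, hℓ, hvol, hdom⟩ :=
    exists_packing_or_exists_covering A hb (fun P => if P ∈ G.terminalPaths τ then w P else 0) v
  · left
    lift f to Finset (Sym2 V) → ℝ≥0 using hf
    refine ⟨f, flowCong_le_iff.2 fun e he => ?_, by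
      simpa [dotProduct, Finset.sum_ite_mem] using hval⟩
    have := hcap e
    simp only [Matrix.mulVec, dotProduct, A, Matrix.of_apply, ite_mul, one_mul, zero_mul, b, he,
      if_true, ← Finset.sum_filter] at this
    rw [← NNReal.coe_le_coe]
    push_cast
    convert this using 2
    ext P
    simp [and_comm]
  · right
    refine ⟨ℓ, hℓ, ?_, fun P hP => ?_⟩
    · refine le_trans ?_ hvol
      rw [dotProduct, Finset.mul_sum]
      calc ∑ e ∈ G.graph.edgeFinset, κ * (G.cap e * ℓ e)
        _ = ∑ e ∈ G.graph.edgeFinset, b e * ℓ e := Finset.sum_congr rfl fun e he => by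
          simp only [b, SimpleGraph.mem_edgeFinset.1 he, if_true, mul_assoc]
        _ ≤ ∑ e, b e * ℓ e := Finset.sum_le_univ_sum_of_nonneg fun e =>
          mul_nonneg (hb e).le (hℓ e)
    · simpa [Matrix.vecMul, dotProduct, A, hP] using hdom P

open Classical in
theorem exists_demand_or_exists_lengths [Fintype ι] (G : CapGraph V) (τ : ι → V)
    {δ : ι → ι → ℝ} (hδ : ∀ t t', 0 ≤ δ t t') (hδ0 : ∀ t, δ t t = 0) {κ : ℝ≥0} (hκ : 0 < κ)
    {v : ℝ} (hv : 0 ≤ v) :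
    (∃ D : Demand ι, G.cong τ D ≤ κ ∧ v < ∑ t, ∑ t', (D.val t t' : ℝ) * δ t t') ∨
    ∃ ℓ : Sym2 V → ℝ, 0 ≤ ℓ ∧ κ * ∑ e ∈ G.graph.edgeFinset, (G.cap e : ℝ) * ℓ e ≤ v ∧
      G.LengthsDominate τ ℓ δ := by
  let d : Finset (Sym2 V) → ι → ι → ℝ := fun P t t' =>
    if P ∈ G.paths (τ t) (τ t') then δ t t' else 0
  have hd : ∀ P t t', 0 ≤ d P t t' := fun P t t' => by
    simp only [d]
    split_ifs
    exacts [hδ t t', le_rfl]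
  have hsub : ∀ t t', G.paths (τ t) (τ t') ⊆ G.terminalPaths τ :=
    fun t t' P hP => mem_terminalPaths.2 ⟨t, t', hP⟩
  obtain ⟨f, hf, hval⟩ | ⟨ℓ, hℓ, hvol, hdom⟩ :=
    exists_flow_or_exists_lengths G τ (fun P => ∑ t, ∑ t', d P t t') hκ v
  · left
    have hsum : ∑ P ∈ G.terminalPaths τ, (∑ t, ∑ t', d P t t') * f P =
        ∑ t, ∑ t', ((∑ P ∈ G.paths (τ t) (τ t'), f P : ℝ≥0) : ℝ) * δ t t' := by
      simp only [d, Finset.sum_mul, NNReal.coe_sum, ite_mul, zero_mul]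
      rw [Finset.sum_comm]
      refine Finset.sum_congr rfl fun t _ => ?_
      rw [Finset.sum_comm]
      simp only [Finset.sum_ite_mem, Finset.inter_eq_right.2 (hsub t _), mul_comm]
    obtain ⟨D, hD, hDval⟩ := exists_demand_of_flow f hδ0 (hsum ▸ (hv.trans_lt hval).ne')
    exact ⟨D, (iInf₂_le f hD).trans hf, by rwa [hDval, ← hsum]⟩
  · right
    refine ⟨ℓ, hℓ, hvol, fun t t' _ P hP => ?_⟩
    calc δ t t' = d P t t' := (if_pos hP).symm
      _ ≤ ∑ t', d P t t' :=
          Finset.single_le_sum (f := d P t) (fun _ _ => hd P t _) (Finset.mem_univ t')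
      _ ≤ ∑ t, ∑ t', d P t t' := Finset.single_le_sum (f := fun t => ∑ t', d P t t')
          (fun _ _ => Finset.sum_nonneg fun _ _ => hd P _ _) (Finset.mem_univ t)
      _ ≤ ∑ e ∈ P, ℓ e := hdom P (hsub t t' hP)

-- Each unordered pair of terminals occurs twice in the sum over `t` and `t'`.
theorem sum_demand_mul_le [Fintype ι] (hτ : Function.Injective τ) {D : Demand ι}
    {f : Finset (Sym2 V) → ℝ≥0} (hf : G.Routes τ f D) {ℓ : Sym2 V → ℝ} (hℓ : 0 ≤ ℓ) {δ : ι → ι → ℝ}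
    (hdom : G.LengthsDominate τ ℓ δ) :
    ∑ t, ∑ t', (D.val t t' : ℝ) * δ t t' ≤
      2 * ∑ P ∈ G.terminalPaths τ, (f P : ℝ) * ∑ e ∈ P, ℓ e := by
  classical
  have hpair : ∀ t t', (D.val t t' : ℝ) * δ t t' ≤ ∑ P ∈ G.terminalPaths τ,
      if t ≠ t' ∧ P ∈ G.paths (τ t) (τ t') then (f P : ℝ) * ∑ e ∈ P, ℓ e else 0 := by
    intro t t'
    rcases eq_or_ne t t' with rfl | h
    · simp [D.diag]
    have hsub : G.paths (τ t) (τ t') ⊆ G.terminalPaths τ :=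
      fun P hP => mem_terminalPaths.2 ⟨t, t', hP⟩
    rw [← hf t t' h, NNReal.coe_sum, Finset.sum_mul]
    simp only [h, ne_eq, not_false_eq_true, true_and, Finset.sum_ite_mem,
      Finset.inter_eq_right.2 hsub]
    exact Finset.sum_le_sum fun P hP =>
      mul_le_mul_of_nonneg_left (hdom t t' h P hP) (f P).coe_nonneg
  calc ∑ t, ∑ t', (D.val t t' : ℝ) * δ t t'
    _ ≤ ∑ t, ∑ t', ∑ P ∈ G.terminalPaths τ,
        if t ≠ t' ∧ P ∈ G.paths (τ t) (τ t') then (f P : ℝ) * ∑ e ∈ P, ℓ e else 0 :=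
      Finset.sum_le_sum fun t _ => Finset.sum_le_sum fun t' _ => hpair t t'
    _ = ∑ P ∈ G.terminalPaths τ, ∑ x : ι × ι,
        if x.1 ≠ x.2 ∧ P ∈ G.paths (τ x.1) (τ x.2) then (f P : ℝ) * ∑ e ∈ P, ℓ e else 0 := by
      simp only [Finset.sum_comm (s := G.terminalPaths τ), Fintype.sum_prod_type]
    _ ≤ ∑ P ∈ G.terminalPaths τ, 2 * ((f P : ℝ) * ∑ e ∈ P, ℓ e) := by
      refine Finset.sum_le_sum fun P _ => ?_
      rw [← Finset.sum_filter, Finset.sum_const, nsmul_eq_mul]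
      refine mul_le_mul_of_nonneg_right ?_
        (mul_nonneg (f P).coe_nonneg (Finset.sum_nonneg fun e _ => hℓ e))
      exact_mod_cast card_terminal_pairs_le_two hτ P
    _ = 2 * ∑ P ∈ G.terminalPaths τ, (f P : ℝ) * ∑ e ∈ P, ℓ e := (Finset.mul_sum ..).symm

open Classical in
theorem sum_flow_mul_le {f : Finset (Sym2 V) → ℝ≥0} {κ : ℝ≥0} (hκ : G.flowCong τ f ≤ κ)
    {ℓ : Sym2 V → ℝ} (hℓ : 0 ≤ ℓ) :
    ∑ P ∈ G.terminalPaths τ, (f P : ℝ) * ∑ e ∈ P, ℓ e ≤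
      κ * ∑ e ∈ G.graph.edgeFinset, (G.cap e : ℝ) * ℓ e := by
  have hsub : ∀ P ∈ G.terminalPaths τ, P ⊆ G.graph.edgeFinset := fun P hP => by
    obtain ⟨t, t', hP⟩ := mem_terminalPaths.1 hP
    exact subset_edgeFinset_of_mem_paths hP
  calc ∑ P ∈ G.terminalPaths τ, (f P : ℝ) * ∑ e ∈ P, ℓ e
    _ = ∑ P ∈ G.terminalPaths τ, ∑ e ∈ G.graph.edgeFinset,
        if e ∈ P then (f P : ℝ) * ℓ e else 0 := Finset.sum_congr rfl fun P hP => by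
      rw [Finset.sum_ite_mem, Finset.inter_eq_right.2 (hsub P hP), Finset.mul_sum]
    _ = ∑ e ∈ G.graph.edgeFinset,
        (∑ P ∈ (G.terminalPaths τ).filter (fun P => e ∈ P), (f P : ℝ)) * ℓ e := by
      rw [Finset.sum_comm]
      simp only [Finset.sum_mul, Finset.sum_filter, ite_mul, zero_mul]
    _ ≤ ∑ e ∈ G.graph.edgeFinset, κ * (G.cap e * ℓ e) := Finset.sum_le_sum fun e he => by
      rw [← mul_assoc]
      refine mul_le_mul_of_nonneg_right ?_ (hℓ e)
      exact_mod_cast flowCong_le_iff.1 hκ e (SimpleGraph.mem_edgeFinset.1 he)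
    _ = κ * ∑ e ∈ G.graph.edgeFinset, (G.cap e : ℝ) * ℓ e := (Finset.mul_sum ..).symm

open Classical in
theorem ofReal_le_cong [Fintype ι] (hτ : Function.Injective τ) {D : Demand ι} {ℓ : Sym2 V → ℝ}
    (hℓ : 0 ≤ ℓ) {δ : ι → ι → ℝ} (hdom : G.LengthsDominate τ ℓ δ) {x : ℝ}
    (hx : 2 * x * ∑ e ∈ G.graph.edgeFinset, (G.cap e : ℝ) * ℓ e <
      ∑ t, ∑ t', (D.val t t' : ℝ) * δ t t') :
    ENNReal.ofReal x ≤ G.cong τ D := by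
  rcases le_total x 0 with hx0 | hx0
  · simp [ENNReal.ofReal_of_nonpos hx0]
  refine le_iInf₂ fun f hf => le_of_not_gt fun hlt => ?_
  have hload := sum_flow_mul_le (κ := x.toNNReal) hlt.le hℓ
  rw [Real.coe_toNNReal x hx0] at hload
  linarith [sum_demand_mul_le hτ hf hℓ hdom]

end CapGraph

section Girth

variable {V : Type*} {G : SimpleGraph V}

theorem egirth_le_length_add_one {u v : V} (h : G.Adj u v) (p : G.Walk v u)
    (hp : s(u, v) ∉ p.edges) : G.egirth ≤ p.length + 1 := by
  classical
  have hcycle : (SimpleGraph.Walk.cons h p.bypass).IsCycle :=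
    (SimpleGraph.Walk.cons_isCycle_iff _ h).2
      ⟨p.bypass_isPath, fun hmem => hp (p.edges_bypass_subset_edges hmem)⟩
  calc G.egirth ≤ (SimpleGraph.Walk.cons h p.bypass).length := SimpleGraph.egirth_le_length hcycle
    _ ≤ p.length + 1 := by exact_mod_cast Nat.succ_le_succ p.length_bypass_le_length

theorem exists_isCycle_cons_of_mem_edges {w x y : V} {c : G.Walk w w} (hc : c.IsCycle)
    (he : s(x, y) ∈ c.edges) :
    ∃ (h : G.Adj x y) (p : G.Walk y x), (SimpleGraph.Walk.cons h p).IsCycle ∧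
      p.length + 1 = c.length := by
  classical
  have hfirst : ∀ d : G.Walk x x, d.IsCycle → d.snd = y →
      ∃ (h : G.Adj x y) (p : G.Walk y x), (SimpleGraph.Walk.cons h p).IsCycle ∧
        p.length + 1 = d.length := by
    rintro d hd rfl
    exact ⟨d.adj_snd hd.not_nil, d.tail, by rwa [d.cons_tail_eq hd.not_nil],
      SimpleGraph.Walk.length_tail_add_one hd.not_nil⟩
  have hx := c.fst_mem_support_of_mem_edges he
  have hy : y ∈ (c.rotate x hx).toSubgraph.neighborSet x :=
    SimpleGraph.Walk.adj_toSubgraph_iff_mem_edges.2 ((c.rotate_edges x hx).perm.symm.subset he)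
  rw [(hc.rotate hx).neighborSet_toSubgraph_endpoint] at hy
  rw [← c.length_rotate x hx]
  obtain hy | hy := hy
  · exact hfirst _ (hc.rotate hx) hy.symm
  · rw [← SimpleGraph.Walk.length_reverse]
    exact hfirst _ (hc.rotate hx).reverse (by simpa using hy.symm)

theorem min_egirth_edist_add_one_le_egirth_sup_edge (G : SimpleGraph V) (x y : V) :
    min G.egirth (G.edist x y + 1) ≤ (G ⊔ SimpleGraph.edge x y).egirth := by
  refine SimpleGraph.le_egirth.2 fun w c hc => ?_
  have hG : ∀ e ∈ (G ⊔ SimpleGraph.edge x y).edgeSet, e ≠ s(x, y) → e ∈ G.edgeSet := by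
    intro e he hne
    induction e with | _ a b
    grind [SimpleGraph.mem_edgeSet]
  by_cases he : s(x, y) ∈ c.edges
  · obtain ⟨h, p, hp, hlen⟩ := exists_isCycle_cons_of_mem_edges hc he
    have hxy := ((SimpleGraph.Walk.cons_isCycle_iff p h).1 hp).2
    have hpG : ∀ e ∈ p.edges, e ∈ G.edgeSet := fun e hep =>
      hG e (p.edges_subset_edgeSet hep) (ne_of_mem_of_not_mem hep hxy)
    refine (min_le_right _ _).trans ?_
    rw [← hlen, ← p.length_transfer hpG, SimpleGraph.edist_comm]
    push_cast
    gcongr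
    exact SimpleGraph.edist_le _
  · have hcG : ∀ e ∈ c.edges, e ∈ G.edgeSet := fun e hec =>
      hG e (c.edges_subset_edgeSet hec) (ne_of_mem_of_not_mem hec he)
    rw [← c.length_transfer hcG]
    exact (min_le_left _ _).trans (SimpleGraph.egirth_le_length (hc.transfer hcG))

theorem isAcyclic_pathGraph (n : ℕ) : (SimpleGraph.pathGraph n).IsAcyclic := by
  intro w c hc
  obtain ⟨m, hm, hmax⟩ := c.support.toFinset.exists_max_image id ⟨w, by simp⟩
  rw [List.mem_toFinset] at hm
  let d := c.rotate m hm
  have hd : d.IsCycle := hc.rotate hm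
  -- Both neighbours on the cycle of its largest vertex `m` are equal to `m - 1`.
  have hpred : ∀ v ∈ d.support, (SimpleGraph.pathGraph n).Adj m v → v.val + 1 = m.val := by
    intro v hv hadj
    have hle : v ≤ m := hmax v (by simpa [d] using hv)
    rw [SimpleGraph.pathGraph_adj] at hadj
    omega
  have hsnd := hpred d.snd (d.getVert_mem_support _) (d.adj_snd hd.not_nil)
  have hpen := hpred d.penultimate (d.getVert_mem_support _) (d.adj_penultimate hd.not_nil).symm
  exact hd.snd_ne_penultimate (Fin.ext (by omega))

/-- Up to radius `h`, distances grow along every edge but at most one at each vertex. -/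
def LocallyTree (G : SimpleGraph V) (h : ℕ) : Prop :=
  ∀ u x y z, G.Adj x y → G.Adj x z → y ≠ z → G.dist u x ≤ h →
    G.dist u y ≤ G.dist u x → G.dist u x < G.dist u z

theorem exists_walk_notMem_support_of_dist_le (hG : G.Connected) {u x y : V} (hxy : G.Adj x y)
    (hle : G.dist u y ≤ G.dist u x) : ∃ p : G.Walk u y, p.length = G.dist u y ∧ x ∉ p.support := by
  classical
  obtain ⟨p, hp⟩ := hG.exists_walk_length_eq_dist u y
  refine ⟨p, hp, fun hx => ?_⟩
  have hsplit := congrArg SimpleGraph.Walk.length (p.take_spec hx)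
  rw [SimpleGraph.Walk.length_append] at hsplit
  have htake := SimpleGraph.dist_le (p.takeUntil x hx)
  have hdrop := SimpleGraph.dist_le (p.dropUntil x hx)
  rw [SimpleGraph.dist_eq_one_iff_adj.2 hxy] at hdrop
  omega

theorem locallyTree_of_lt_egirth (hG : G.Connected) {h : ℕ}
    (hgirth : ((2 * h + 2 : ℕ) : ℕ∞) < G.egirth) : LocallyTree G h := by
  intro u x y z hxy hxz hyz hux huy
  by_contra! huz
  obtain ⟨p, hp, hxp⟩ := exists_walk_notMem_support_of_dist_le hG hxy huy
  obtain ⟨q, hq, hxq⟩ := exists_walk_notMem_support_of_dist_le hG hxz huz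
  have hshort := hgirth.trans_le <|
    egirth_le_length_add_one hxz ((q.reverse.append p).concat hxy.symm) (by
      have hpx : s(x, z) ∉ p.edges := fun h => hxp (p.fst_mem_support_of_mem_edges h)
      have hqx : s(x, z) ∉ q.edges := fun h => hxq (q.fst_mem_support_of_mem_edges h)
      simp [hpx, hqx, hyz.symm, hxy.ne])
  simp only [SimpleGraph.Walk.length_concat, SimpleGraph.Walk.length_append,
    SimpleGraph.Walk.length_reverse] at hshort
  norm_cast at hshort
  omega

theorem LocallyTree.dist_add {h : ℕ} (hG : LocallyTree G h) (hc : G.Connected)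
    {u v x y : V} (hvx : G.Adj v x) (hux : G.dist u v < G.dist u x)
    (hyx : G.dist y x < G.dist y v) (hle : G.dist u x + G.dist y x ≤ h + 1) :
    G.dist u y = G.dist u x + G.dist y x := by
  induction hj : G.dist y x generalizing v x with
  | zero => rw [(hc.dist_eq_zero_iff).1 hj, add_zero]
  | succ j ih =>
    obtain ⟨p, hp⟩ := hc.exists_walk_length_eq_dist x y
    rw [SimpleGraph.dist_comm, hj] at hp
    cases p with
    | nil => simp at hp
    | @cons _ x' _ hxx' q =>
      simp only [SimpleGraph.Walk.length_cons, add_left_inj] at hp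
      have hx'y : G.dist y x' ≤ j := by
        rw [SimpleGraph.dist_comm, ← hp]
        exact SimpleGraph.dist_le q
      have hne : v ≠ x' := by rintro rfl; omega
      have hux' := hG u x v x' hvx.symm hxx' hne (by omega) hux.le
      have hu := hxx'.diff_dist_adj (u := u)
      have hy := hxx'.diff_dist_adj (u := y)
      have := ih hxx' hux' (by omega) (by omega) (by omega)
      omega

section Balls

variable [Fintype V] [DecidableRel G.Adj]

theorem card_ball_le (hc : G.Connected) {K : ℕ} (hK : ∀ v, G.degree v ≤ K) (u : V) (ρ : ℕ) :
    (Finset.univ.filter fun v => G.dist u v ≤ ρ).card ≤ (K + 1) ^ ρ := by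
  classical
  induction ρ with
  | zero => simp [hc.dist_eq_zero_iff, Finset.filter_eq]
  | succ ρ ih =>
    have hsub : (Finset.univ.filter fun v => G.dist u v ≤ ρ + 1) ⊆
        (Finset.univ.filter fun v => G.dist u v ≤ ρ).biUnion
          fun v => insert v (G.neighborFinset v) := by
      intro v hv
      simp only [Finset.mem_filter_univ, Finset.mem_biUnion, Finset.mem_insert,
        SimpleGraph.mem_neighborFinset] at hv ⊢
      obtain ⟨p, hp⟩ := hc.exists_walk_length_eq_dist v u
      cases p with
      | nil => exact ⟨u, by simp, .inl rfl⟩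
      | @cons _ w _ hvw q =>
        refine ⟨w, ?_, .inr hvw.symm⟩
        rw [SimpleGraph.dist_comm] at hv ⊢
        rw [SimpleGraph.Walk.length_cons] at hp
        exact (SimpleGraph.dist_le q).trans (by omega)
    calc (Finset.univ.filter fun v => G.dist u v ≤ ρ + 1).card
      _ ≤ (Finset.univ.filter fun v => G.dist u v ≤ ρ).card * (K + 1) :=
        (Finset.card_le_card hsub).trans (Finset.card_biUnion_le_card_mul _ _ _ fun v _ =>
          (Finset.card_insert_le _ _).trans (Nat.succ_le_succ (hK v)))
      _ ≤ (K + 1) ^ (ρ + 1) := by rw [pow_succ]; gcongr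

theorem LocallyTree.le_card_neighbors_sphere {h d : ℕ} (hG : LocallyTree G h) (u : V) {x : V}
    (hx : G.dist u x ≤ h) (hd : d + 1 ≤ G.degree x) :
    d ≤ (Finset.univ.filter fun y => G.dist u y = G.dist u x + 1 ∧ G.Adj x y).card := by
  classical
  have hback : (Finset.univ.filter fun y => G.Adj x y ∧ G.dist u y ≤ G.dist u x).card ≤ 1 := by
    refine Finset.card_le_one.2 fun y hy z hz => ?_
    rw [Finset.mem_filter_univ] at hy hz
    by_contra hyz
    exact (hG u x y z hy.1 hz.1 hyz hx hy.2).not_ge hz.2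
  have hsub : G.neighborFinset x ⊆
      (Finset.univ.filter fun y => G.dist u y = G.dist u x + 1 ∧ G.Adj x y) ∪
        Finset.univ.filter fun y => G.Adj x y ∧ G.dist u y ≤ G.dist u x := by
    intro y hy
    rw [SimpleGraph.mem_neighborFinset] at hy
    have := hy.diff_dist_adj (u := u)
    simp only [Finset.mem_union, Finset.mem_filter_univ, hy, and_true, true_and]
    omega
  have := (Finset.card_le_card hsub).trans (Finset.card_union_le _ _)
  rw [SimpleGraph.card_neighborFinset_eq_degree] at this
  omega

theorem LocallyTree.pow_le_card_sphere {h d : ℕ} (hG : LocallyTree G h) (u : V) {ρ : ℕ}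
    (hρ : ρ ≤ h) (hd : ∀ v, G.dist u v < ρ → d + 1 ≤ G.degree v) :
    d ^ ρ ≤ (Finset.univ.filter fun v => G.dist u v = ρ).card := by
  classical
  induction ρ with
  | zero => exact Finset.card_pos.2 ⟨u, by simp⟩
  | succ ρ ih =>
    let S := Finset.univ.filter fun v => G.dist u v = ρ
    let N : V → Finset V := fun x => Finset.univ.filter fun y => G.dist u y = ρ + 1 ∧ G.Adj x y
    have hN : ∀ x ∈ S, d ≤ (N x).card := fun x hx => by
      obtain rfl := (Finset.mem_filter_univ x).1 hx
      exact hG.le_card_neighbors_sphere u (by omega) (hd x (by omega))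
    have hdisj : (S : Set V).PairwiseDisjoint N := by
      intro x hx z hz hxz
      simp only [S, Finset.coe_filter_univ, Set.mem_ofPred_eq] at hx hz
      refine Finset.disjoint_left.2 fun y hy hy' => ?_
      simp only [N, Finset.mem_filter_univ] at hy hy'
      have := hG u y x z hy.2.symm hy'.2.symm hxz (by omega) (by omega)
      omega
    calc d ^ (ρ + 1) = d ^ ρ * d := pow_succ _ _
      _ ≤ S.card * d := Nat.mul_le_mul_right d (ih (by omega) fun v hv => hd v (by omega))
      _ ≤ ∑ x ∈ S, (N x).card := Finset.card_nsmul_le_sum S _ d hN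
      _ = (S.biUnion N).card := (Finset.card_biUnion hdisj).symm
      _ ≤ (Finset.univ.filter fun v => G.dist u v = ρ + 1).card := Finset.card_le_card <|
        Finset.biUnion_subset.2 fun x _ y hy => by
          simp only [N, Finset.mem_filter_univ] at hy ⊢
          exact hy.1

end Balls

end Girth

section Matchings

variable {V A : Type*} {G₀ : SimpleGraph V} {π : A → Equiv.Perm V} {g : ℕ}

/-- The graph `G₀` together with the pairs matched by the involutions `π a`. -/
def graphSupMatchings (G₀ : SimpleGraph V) (π : A → Equiv.Perm V) : SimpleGraph V :=
  G₀ ⊔ SimpleGraph.fromRel fun x y => ∃ a, π a x = y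

/-- A family of pairwise disjoint matchings which, added to `G₀`, creates no cycle of length at most
`g + 1`. A matching is encoded as an involution, whose fixed points are the unmatched vertices. -/
structure IsSparseMatching (G₀ : SimpleGraph V) (g : ℕ) (π : A → Equiv.Perm V) : Prop where
  involutive : ∀ a, Function.Involutive (π a)
  eq_of_apply_eq : ∀ a b v, π a v = π b v → π a v ≠ v → a = b
  lt_egirth : ((g + 1 : ℕ) : ℕ∞) < (graphSupMatchings G₀ π).egirth

theorem graphSupMatchings_adj (hπ : ∀ a, Function.Involutive (π a)) {x y : V} :
    (graphSupMatchings G₀ π).Adj x y ↔ G₀.Adj x y ∨ x ≠ y ∧ ∃ a, π a x = y := by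
  have hsymm : (∃ a, π a y = x) ↔ ∃ a, π a x = y :=
    exists_congr fun a => (hπ a).eq_iff.trans eq_comm
  rw [graphSupMatchings, SimpleGraph.sup_adj, SimpleGraph.fromRel_adj, hsymm, or_self]

theorem connected_graphSupMatchings (hG₀ : G₀.Connected) (π : A → Equiv.Perm V) :
    (graphSupMatchings G₀ π).Connected :=
  hG₀.mono le_sup_left

theorem isSparseMatching_one (hg : ((g + 1 : ℕ) : ℕ∞) < G₀.egirth) :
    IsSparseMatching G₀ g (1 : A → Equiv.Perm V) where
  involutive _ _ := rfl
  eq_of_apply_eq _ _ _ _ h := absurd rfl h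
  lt_egirth := by
    have : graphSupMatchings G₀ (1 : A → Equiv.Perm V) = G₀ := by
      ext x y
      rw [graphSupMatchings_adj fun _ _ => rfl]
      simp +contextual
    rwa [this]

section Update

variable [DecidableEq V] [DecidableEq A]

theorem update_mul_swap_apply_eq_iff {a : A} {x y : V} (hx : π a x = x) (hy : π a y = y)
    {b : A} {u v : V} (huv : u ≠ v) :
    Function.update π a (π a * Equiv.swap x y) b u = v ↔
      π b u = v ∨ b = a ∧ (u = x ∧ v = y ∨ u = y ∧ v = x) := by
  rcases eq_or_ne b a with rfl | hb
  · rw [Function.update_self, Equiv.Perm.mul_apply, Equiv.swap_apply_def]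
    grind
  · simp [hb]

theorem IsSparseMatching.update (hG₀ : G₀.Connected) (hg : 1 ≤ g) (hπ : IsSparseMatching G₀ g π)
    {a : A} {x y : V} (hx : π a x = x) (hy : π a y = y)
    (hdist : g < (graphSupMatchings G₀ π).dist x y) :
    IsSparseMatching G₀ g (Function.update π a (π a * Equiv.swap x y)) := by
  have hxy : x ≠ y := by rintro rfl; simp at hdist
  have hnadj : ¬ (graphSupMatchings G₀ π).Adj x y := fun h => by
    rw [SimpleGraph.dist_eq_one_iff_adj.2 h] at hdist
    omega
  have hunmatched : ∀ b, π b x ≠ y ∧ π b y ≠ x := fun b => by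
    have hb : π b x ≠ y := fun hb =>
      hnadj ((graphSupMatchings_adj hπ.involutive).2 (.inr ⟨hxy, b, hb⟩))
    exact ⟨hb, fun h => hb ((hπ.involutive b).eq_iff.1 h).symm⟩
  have key := fun b {u v} (huv : u ≠ v) =>
    update_mul_swap_apply_eq_iff (b := b) hx hy huv
  generalize Function.update π a (π a * Equiv.swap x y) = π' at key
  have hinv : ∀ b, Function.Involutive (π' b) := fun b v => by
    rcases eq_or_ne (π' b v) v with h | h
    · rw [h, h]
    · have hπb := (hπ.involutive b).eq_iff (x := v) (y := π' b v)
      rw [key b h]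
      grind [key b h.symm]
  refine ⟨hinv, fun b c v h hv => ?_, ?_⟩
  · have hb := (key b hv.symm).1 rfl
    have hc := (key c hv.symm).1 h.symm
    grind [hπ.eq_of_apply_eq b c v]
  · have hsup : graphSupMatchings G₀ π' = graphSupMatchings G₀ π ⊔ SimpleGraph.edge x y := by
      ext u v
      rw [SimpleGraph.sup_adj, SimpleGraph.edge_adj, graphSupMatchings_adj hπ.involutive,
        graphSupMatchings_adj hinv]
      rcases eq_or_ne u v with rfl | huv
      · simp
      · simp only [key _ huv, exists_or, exists_and_right, exists_eq]
        tauto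
    rw [hsup]
    refine lt_of_lt_of_le (lt_min hπ.lt_egirth ?_)
      (min_egirth_edist_add_one_le_egirth_sup_edge _ x y)
    rw [← ((connected_graphSupMatchings hG₀ π).preconnected x y).coe_dist_eq_edist]
    exact_mod_cast Nat.succ_lt_succ hdist

end Update

theorem degree_graphSupMatchings_le [Fintype V] [Fintype A] [DecidableRel G₀.Adj]
    [DecidableRel (graphSupMatchings G₀ π).Adj] (hπ : ∀ a, Function.Involutive (π a)) (v : V) :
    (graphSupMatchings G₀ π).degree v ≤ G₀.degree v + Fintype.card A := by
  classical
  have hsub : (graphSupMatchings G₀ π).neighborFinset v ⊆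
      G₀.neighborFinset v ∪ Finset.univ.image fun a => π a v := by
    intro w hw
    rw [SimpleGraph.mem_neighborFinset, graphSupMatchings_adj hπ] at hw
    simp only [Finset.mem_union, SimpleGraph.mem_neighborFinset, Finset.mem_image, Finset.mem_univ,
      true_and]
    exact hw.imp_right And.right
  exact (Finset.card_le_card hsub).trans <| (Finset.card_union_le _ _).trans <|
    Nat.add_le_add_left Finset.card_image_le _

-- The greedy argument of Erdős and Sachs: a family with the fewest unmatched vertices cannot be
-- enlarged, so the vertices unmatched by `π a` lie within distance `g` of each other.
theorem exists_isSparseMatching [Fintype V] [DecidableEq V] [Fintype A] [DecidableRel G₀.Adj]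
    (hG₀ : G₀.Connected) (hg : 1 ≤ g) (hgirth : ((g + 1 : ℕ) : ℕ∞) < G₀.egirth) {d : ℕ}
    (hd : ∀ v, G₀.degree v ≤ d) :
    ∃ π : A → Equiv.Perm V, IsSparseMatching G₀ g π ∧
      ∀ a, (Finset.univ.filter fun v => π a v = v).card ≤ (d + Fintype.card A + 1) ^ g := by
  classical
  let unmatched : (A → Equiv.Perm V) → A → Finset V := fun π b =>
    Finset.univ.filter fun v => π b v = v
  obtain ⟨π, hπ, hmin⟩ := Set.exists_min_image {π : A → Equiv.Perm V | IsSparseMatching G₀ g π}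
    (fun π => ∑ b, (unmatched π b).card) (Set.toFinite _) ⟨1, isSparseMatching_one hgirth⟩
  refine ⟨π, hπ, fun a => ?_⟩
  obtain h0 | ⟨x, hx⟩ := (unmatched π a).eq_empty_or_nonempty
  · exact (Finset.card_eq_zero.2 h0).trans_le (Nat.zero_le _)
  refine le_trans (Finset.card_le_card fun y hy => ?_)
    (card_ball_le (connected_graphSupMatchings hG₀ π)
      (fun v => (degree_graphSupMatchings_le hπ.involutive v).trans
        (Nat.add_le_add_right (hd v) _)) x g)
  rw [Finset.mem_filter_univ] at hx hy ⊢
  by_contra! hlt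
  have hxy : x ≠ y := by rintro rfl; simp at hlt
  have hsub : ∀ b, unmatched (Function.update π a (π a * Equiv.swap x y)) b ⊆ unmatched π b := by
    intro b v hv
    rw [Finset.mem_filter_univ] at hv ⊢
    by_contra hne
    exact hne <| ((update_mul_swap_apply_eq_iff hx hy (Ne.symm hne)).2 (.inl rfl)).symm.trans hv
  refine (hmin _ (hπ.update hG₀ hg hx hy hlt)).not_gt <|
    Finset.sum_lt_sum (fun b _ => Finset.card_le_card (hsub b)) ⟨a, Finset.mem_univ a,
      Finset.card_lt_card ((Finset.ssubset_iff_of_subset (hsub a)).2 ⟨x, ?_, ?_⟩)⟩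
  · simpa [unmatched] using hx
  · simp [unmatched, hy, hxy.symm]

end Matchings

theorem exists_dominating_finset {V : Type*} [Fintype V] {G : SimpleGraph V} (hG : G.Connected)
    (S : Finset V) {ρ b k : ℕ} (hb : 0 < b)
    (hball : ∀ u ∈ S, b ≤ (Finset.univ.filter fun v => G.dist u v ≤ ρ).card)
    (hk : Fintype.card V ≤ b * k) (hkV : k ≤ Fintype.card V) :
    ∃ T : Finset V, T.card = k ∧ ∀ u ∈ S, ∃ t ∈ T, G.dist u t ≤ 2 * ρ := by
  classical
  let Separated (A : Finset V) : Prop := ∀ x ∈ A, ∀ y ∈ A, x ≠ y → 2 * ρ < G.dist x y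
  obtain ⟨A, hA, hmax⟩ := Finset.exists_max_image (S.powerset.filter Separated) Finset.card
    ⟨∅, by simp [Separated]⟩
  simp only [Finset.mem_filter, Finset.mem_powerset] at hA hmax
  have hdisj : (A : Set V).PairwiseDisjoint fun u =>
      Finset.univ.filter fun v => G.dist u v ≤ ρ := by
    intro x hx y hy hxy
    rw [Function.onFun, Finset.disjoint_left]
    intro v hxv hyv
    simp only [Finset.mem_filter, Finset.mem_univ, true_and] at hxv hyv
    have hfar := hA.2 x hx y hy hxy
    have htri := hG.dist_triangle (u := x) (v := v) (w := y)
    rw [SimpleGraph.dist_comm (u := v)] at htri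
    omega
  have hcard : A.card * b ≤ Fintype.card V := by
    rw [← smul_eq_mul, ← Finset.sum_const]
    refine (Finset.sum_le_sum fun u hu => hball u (hA.1 hu)).trans ?_
    rw [← Finset.card_biUnion hdisj]
    exact Finset.card_le_univ _
  have hAk : A.card ≤ k :=
    Nat.le_of_mul_le_mul_left ((mul_comm b _).trans_le (hcard.trans hk)) hb
  obtain ⟨T, hAT, hT⟩ := Finset.exists_superset_card_eq hAk hkV
  refine ⟨T, hT, fun u hu => ?_⟩
  by_contra! hfar
  have huA : u ∉ A := fun h => by simpa using hfar u (hAT h)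
  have hins : Separated (insert u A) := by
    intro x hx y hy hxy
    rw [Finset.mem_insert] at hx hy
    rcases hx with rfl | hx <;> rcases hy with rfl | hy
    · exact absurd rfl hxy
    · exact hfar y (hAT hy)
    · rw [SimpleGraph.dist_comm]; exact hfar x (hAT hx)
    · exact hA.2 x hx y hy hxy
  have hle := hmax (insert u A) ⟨Finset.insert_subset hu hA.1, hins⟩
  rw [Finset.card_insert_of_notMem huA] at hle
  omega

section AvoidingPermutation

variable {V K : Type*} [Fintype V] [DecidableEq V]

-- Averaging over the cyclic shifts of `V`, each of which moves a point to each place once.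
theorem exists_perm_card_mem_le (near : V → Finset V) {B : ℕ} (hB : ∀ u, (near u).card ≤ B) :
    ∃ σ : Equiv.Perm V, (Finset.univ.filter fun u => σ u ∈ near u).card ≤ B := by
  cases isEmpty_or_nonempty V with
  | inl h => exact ⟨1, by simp [Finset.univ_eq_empty]⟩
  | inr h =>
    have : NeZero (Fintype.card V) := ⟨Fintype.card_ne_zero⟩
    let e : V ≃ Fin (Fintype.card V) := Fintype.equivFin V
    let shift (j : Fin (Fintype.card V)) : Equiv.Perm V :=
      (e.trans (Equiv.addLeft j)).trans e.symm
    have hsum : ∑ j, (Finset.univ.filter fun u => shift j u ∈ near u).card ≤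
        ∑ _j : Fin (Fintype.card V), B := by
      calc ∑ j, (Finset.univ.filter fun u => shift j u ∈ near u).card
          = ∑ u, ∑ j, if shift j u ∈ near u then 1 else 0 := by
            simp only [Finset.card_filter]
            exact Finset.sum_comm
        _ = ∑ u, ∑ v, if v ∈ near u then 1 else 0 := Finset.sum_congr rfl fun u _ =>
            Equiv.sum_comp ((Equiv.addRight (e u)).trans e.symm) fun v =>
              if v ∈ near u then 1 else 0
        _ ≤ ∑ _u : V, B := Finset.sum_le_sum fun u _ => by simpa using hB u
        _ = ∑ _j : Fin (Fintype.card V), B := by simp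
    obtain ⟨j, _, hj⟩ := Finset.exists_le_of_sum_le Finset.univ_nonempty hsum
    exact ⟨shift j, hj⟩

variable [Fintype K]

theorem exists_perm_fiber_card_mem_le (cl : V → K) (near : V → Finset V) {B : ℕ}
    (hB : ∀ u, (near u).card ≤ B) :
    ∃ σ : Equiv.Perm V, (∀ u, cl (σ u) = cl u) ∧
      (Finset.univ.filter fun u => σ u ∈ near u).card ≤ Fintype.card K * B := by
  classical
  have hfiber (k : K) : ∃ σ : Equiv.Perm {v // cl v = k},
      (Finset.univ.filter fun u : {v // cl v = k} => (σ u : V) ∈ near u).card ≤ B := by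
    obtain ⟨σ, hσ⟩ := exists_perm_card_mem_le (B := B)
      (fun u : {v // cl v = k} => (near u).subtype fun v => cl v = k) fun u =>
        (Finset.card_subtype _ _).trans_le ((Finset.card_filter_le _ _).trans (hB u))
    exact ⟨σ, by simpa only [Finset.mem_subtype] using hσ⟩
  choose τ hτ using hfiber
  let σ : Equiv.Perm V := ((Equiv.sigmaFiberEquiv cl).symm.trans (Equiv.sigmaCongrRight τ)).trans
    (Equiv.sigmaFiberEquiv cl)
  have hσ (u : V) : σ u = τ (cl u) ⟨u, rfl⟩ := rfl
  refine ⟨σ, fun u => (τ (cl u) ⟨u, rfl⟩).2, ?_⟩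
  have hsub : (Finset.univ.filter fun u => σ u ∈ near u) ⊆ Finset.univ.biUnion fun k =>
      (Finset.univ.filter fun u : {v // cl v = k} => (τ k u : V) ∈ near u).map
        (Function.Embedding.subtype _) := by
    intro u hu
    rw [Finset.mem_filter, hσ] at hu
    simp only [Finset.mem_biUnion, Finset.mem_map, Finset.mem_filter, Finset.mem_univ, true_and]
    exact ⟨cl u, ⟨u, rfl⟩, hu.2, rfl⟩
  calc (Finset.univ.filter fun u => σ u ∈ near u).card
      ≤ ∑ k, ((Finset.univ.filter fun u : {v // cl v = k} => (τ k u : V) ∈ near u).map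
          (Function.Embedding.subtype _)).card :=
        (Finset.card_le_card hsub).trans Finset.card_biUnion_le
    _ ≤ ∑ _k : K, B := Finset.sum_le_sum fun k _ => (Finset.card_map _).trans_le (hτ k)
    _ = Fintype.card K * B := by simp

theorem exists_perm_fiber_fixing_compl (cl : V → K) (S : Finset V) (near : V → Finset V) {B : ℕ}
    (hB : ∀ u, (near u).card ≤ B) :
    ∃ σ : Equiv.Perm V, (∀ u, cl (σ u) = cl u) ∧ (∀ u ∈ S, σ u ∈ S) ∧ (∀ u ∉ S, σ u = u) ∧
      (Finset.univ.filter fun u => σ u ∈ near u).card ≤ Sᶜ.card + Fintype.card K * B := by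
  obtain ⟨τ, hcl, hnear⟩ := exists_perm_fiber_card_mem_le (fun v : S => cl v)
    (fun u => (near u).subtype (· ∈ S)) fun u =>
      (Finset.card_subtype _ _).trans_le ((Finset.card_filter_le _ _).trans (hB u))
  have hmem (u : V) (hu : u ∈ S) : Equiv.Perm.ofSubtype τ u = τ ⟨u, hu⟩ :=
    Equiv.Perm.ofSubtype_apply_of_mem τ hu
  have hnot (u : V) (hu : u ∉ S) : Equiv.Perm.ofSubtype τ u = u :=
    Equiv.Perm.ofSubtype_apply_of_not_mem τ hu
  refine ⟨Equiv.Perm.ofSubtype τ, fun u => ?_, fun u hu => ?_, hnot, ?_⟩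
  · by_cases hu : u ∈ S
    · rw [hmem u hu]; exact hcl ⟨u, hu⟩
    · rw [hnot u hu]
  · rw [hmem u hu]; exact (τ ⟨u, hu⟩).2
  · have hsub : (Finset.univ.filter fun u => Equiv.Perm.ofSubtype τ u ∈ near u) ⊆
        Sᶜ ∪ (Finset.univ.filter fun u : S => (τ u : V) ∈ near u).map
          (Function.Embedding.subtype _) := by
      intro u hu
      rw [Finset.mem_filter] at hu
      by_cases huS : u ∈ S
      · rw [hmem u huS] at hu
        simp [huS, hu.2]
      · simp [huS]
    refine (Finset.card_le_card hsub).trans ((Finset.card_union_le _ _).trans ?_)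
    rw [Finset.card_map]
    exact Nat.add_le_add_left (by simpa only [Finset.mem_subtype] using hnear) _

end AvoidingPermutation

section Trajectories

variable {V A : Type*}

/-- The position after `i` steps, as a permutation of the starting points, where step number `j`
applies `σ` and then `π (a j)`. -/
def trajectory (σ : Equiv.Perm V) (π : A → Equiv.Perm V) (a : ℕ → A) : ℕ → Equiv.Perm V
  | 0 => 1
  | i + 1 => π (a i) * (σ * trajectory σ π a i)

theorem trajectory_congr (σ : Equiv.Perm V) (π : A → Equiv.Perm V) {a b : ℕ → A} {i : ℕ}
    (h : ∀ j < i, a j = b j) : trajectory σ π a i = trajectory σ π b i := by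
  induction i with
  | zero => rfl
  | succ i ih =>
    rw [trajectory, trajectory, h i (by omega), ih fun j hj => h j (by omega)]

variable [Fintype A]

theorem card_mul_sum_apply {ι : Type*} [Fintype ι] [DecidableEq ι] (i : ι) (f : (ι → A) → A → ℝ)
    (hf : ∀ a b c, f (Function.update a i b) c = f a c) :
    Fintype.card A * ∑ a, f a (a i) = ∑ a, ∑ c, f a c := by
  have hinv : Function.Involutive
      fun x : (ι → A) × A => (Function.update x.1 i x.2, x.1 i) := fun x => by simp
  calc Fintype.card A * ∑ a, f a (a i) = ∑ x : (ι → A) × A, f x.1 (x.1 i) := by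
        simp [Fintype.sum_prod_type, Finset.mul_sum]
    _ = ∑ x : (ι → A) × A, f x.1 x.2 := by
        rw [← Equiv.sum_comp hinv.toPerm]
        simp [hf]
    _ = ∑ a, ∑ c, f a c := Fintype.sum_prod_type _

variable [Fintype V]

-- The colour used at time `i` is independent of the position at time `i`.
theorem card_mul_sum_trajectory (σ : Equiv.Perm V) (π : A → Equiv.Perm V) {M : ℕ} [NeZero M]
    (i : Fin M) (f : V → V → A → ℝ) :
    Fintype.card A *
        ∑ a : Fin M → A, ∑ x, f x (trajectory σ π (fun j => a (Fin.ofNat M j)) i x) (a i) =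
      ∑ a : Fin M → A, ∑ x, ∑ c, f x (trajectory σ π (fun j => a (Fin.ofNat M j)) i x) c := by
  have hindep (a : Fin M → A) (b : A) :
      trajectory σ π (fun j => Function.update a i b (Fin.ofNat M j)) i =
        trajectory σ π (fun j => a (Fin.ofNat M j)) i := by
    refine trajectory_congr σ π fun j hj => Function.update_of_ne (fun hji => ?_) _ _
    have : j % M = i := congrArg Fin.val hji
    rw [Nat.mod_eq_of_lt (hj.trans i.2)] at this
    omega
  rw [card_mul_sum_apply i
    (fun a c => ∑ x, f x (trajectory σ π (fun j => a (Fin.ofNat M j)) i x) c)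
    fun a b c => by simp only [hindep]]
  exact Finset.sum_congr rfl fun a _ => Finset.sum_comm

-- First moment method: for a uniformly random start and random steps, the position at each time is
-- uniformly distributed, because a trajectory is a permutation of the starting points.
theorem exists_trajectory_weight_lt_one (σ : Equiv.Perm V) (π : A → Equiv.Perm V) {M : ℕ}
    [NeZero M] (g : V → ℝ) (f : V → A → ℝ) (F : V → V → A → ℝ) (hF : ∀ x v, ∑ c, F x v c ≤ 1)
    (hsum : Fintype.card A * ∑ v, g v + M * (∑ v, ∑ c, f v c + Fintype.card V) <
      Fintype.card A * Fintype.card V) :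
    ∃ (u : ℕ → V) (c : ℕ → A), (∀ i, u (i + 1) = π (c i) (σ (u i))) ∧
      g (u 0) + ∑ i ∈ Finset.range M, (f (u i) (c i) + F (u 0) (u i) (c i)) < 1 := by
  let u (a : Fin M → A) (x : V) (i : ℕ) : V := trajectory σ π (fun j => a (Fin.ofNat M j)) i x
  let weight (a : Fin M → A) (x : V) : ℝ :=
    g x + ∑ i : Fin M, (f (u a x i) (a i) + F x (u a x i) (a i))
  have hA : Nonempty A := by
    by_contra hA
    rw [not_nonempty_iff] at hA
    have : (0 : ℝ) ≤ M * Fintype.card V := by positivity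
    simp only [Fintype.card_eq_zero, CharP.cast_eq_zero, zero_mul, Finset.univ_eq_empty,
      Finset.sum_empty, Finset.sum_const_zero, zero_add] at hsum
    linarith
  have hstep (i : Fin M) :
      Fintype.card A * ∑ a, ∑ x, (f (u a x i) (a i) + F x (u a x i) (a i)) ≤
        ∑ _a : Fin M → A, (∑ v, ∑ c, f v c + Fintype.card V) := by
    rw [card_mul_sum_trajectory σ π i fun x v c => f v c + F x v c]
    refine Finset.sum_le_sum fun a _ => ?_
    simp only [Finset.sum_add_distrib]
    gcongr ?_ + ?_
    · exact (Equiv.sum_comp _ fun v => ∑ c, f v c).le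
    · calc _ ≤ ∑ _x : V, (1 : ℝ) := Finset.sum_le_sum fun x _ => hF x _
        _ = Fintype.card V := by simp
  have hweight : ∑ a, ∑ x, weight a x < ∑ _a : Fin M → A, ∑ _x : V, (1 : ℝ) := by
    have hsteps : Fintype.card A *
        ∑ a, ∑ x, ∑ i : Fin M, (f (u a x i) (a i) + F x (u a x i) (a i)) ≤
          ∑ _i : Fin M, ∑ _a : Fin M → A, (∑ v, ∑ c, f v c + Fintype.card V) := by
      rw [Finset.sum_congr rfl fun a _ => Finset.sum_comm, Finset.sum_comm, Finset.mul_sum]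
      exact Finset.sum_le_sum fun i _ => hstep i
    have hP : (0 : ℝ) < Fintype.card (Fin M → A) := by exact_mod_cast Fintype.card_pos
    refine lt_of_mul_lt_mul_left ?_ (Nat.cast_nonneg (Fintype.card A))
    simp only [weight, Finset.sum_add_distrib (f := fun x => g x)]
    rw [Finset.sum_add_distrib]
    simp only [Finset.sum_const, Finset.card_univ, nsmul_eq_mul, Fintype.card_fin] at hsteps ⊢
    linarith [mul_lt_mul_of_pos_left hsum hP]
  obtain ⟨a, _, ha⟩ := Finset.exists_lt_of_sum_lt hweight
  obtain ⟨x, _, hx⟩ := Finset.exists_lt_of_sum_lt ha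
  refine ⟨u a x, fun j => a (Fin.ofNat M j), fun i => rfl, lt_of_eq_of_lt ?_ hx⟩
  simp [Finset.sum_range, weight, u, trajectory]

end Trajectories

section NonbacktrackingWalks

variable {V A : Type*} {G : SimpleGraph V} {π : A → Equiv.Perm V} {h : ℕ}

/-- A proper colouring of some of the edges of `G`. The edges of colour `a` are encoded by the
involution `π a` that exchanges their endpoints and fixes all other vertices. -/
structure IsPartialEdgeColoring (G : SimpleGraph V) (π : A → Equiv.Perm V) : Prop where
  involutive : ∀ a, Function.Involutive (π a)
  adj : ∀ {a v}, π a v ≠ v → G.Adj v (π a v)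
  eq_of_apply_eq : ∀ a b v, π a v = π b v → π a v ≠ v → a = b

theorem IsSparseMatching.isPartialEdgeColoring {G₀ : SimpleGraph V} {g : ℕ}
    (hπ : IsSparseMatching G₀ g π) : IsPartialEdgeColoring (graphSupMatchings G₀ π) π where
  involutive := hπ.involutive
  adj {a _} hv := (graphSupMatchings_adj hπ.involutive).2 (Or.inr ⟨hv.symm, a, rfl⟩)
  eq_of_apply_eq := hπ.eq_of_apply_eq

/-- The edge of colour `c` at `w` does not lead away from `y`, although `w` is so close to `y` that
the graph looks like a tree from `y`. -/
def Retreats (G : SimpleGraph V) (π : A → Equiv.Perm V) (h : ℕ) (y w : V) (c : A) : Prop :=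
  π c w ≠ w ∧ G.dist y w ≤ h ∧ G.dist y (π c w) ≤ G.dist y w

theorem LocallyTree.card_retreats_le_one [Fintype A] (hG : LocallyTree G h)
    (hπ : IsPartialEdgeColoring G π) (y w : V) [DecidablePred (Retreats G π h y w)] :
    (Finset.univ.filter (Retreats G π h y w)).card ≤ 1 := by
  rw [Finset.card_le_one]
  intro c hc c' hc'
  obtain ⟨hne, hle, hback⟩ := (Finset.mem_filter.1 hc).2
  obtain ⟨hne', -, hback'⟩ := (Finset.mem_filter.1 hc').2
  by_contra hcc
  have hww : π c w ≠ π c' w := fun hw => hcc (hπ.eq_of_apply_eq c c' w hw hne)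
  exact (hG y w _ _ (hπ.adj hne) (hπ.adj hne') hww hle hback).not_ge hback'

/-- A walk `u 0, σ (u 0), u 1, σ (u 1), …` that alternates between jumps along `σ` and steps along
the edges of colours `c 0, c 1, …`, where among the first `M` steps every step is along an actual
edge that retreats neither from the starting point nor, traversed backwards, from the end of the
next jump. -/
structure IsNonbacktracking (G : SimpleGraph V) (π : A → Equiv.Perm V) (h : ℕ) (σ : Equiv.Perm V)
    (M : ℕ) (u : ℕ → V) (c : ℕ → A) : Prop where
  step : ∀ i, u (i + 1) = π (c i) (σ (u i))
  apply_ne : ∀ i < M, π (c i) (σ (u i)) ≠ σ (u i)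
  not_retreats : ∀ i < M, ¬ Retreats G π h (u 0) (σ (u i)) (c i)
  not_retreats_succ : ∀ i < M, ¬ Retreats G π h (σ (u (i + 1))) (u (i + 1)) (c i)

section Existence

variable [Fintype V] [Fintype A]

open Classical in
theorem LocallyTree.sum_retreats_le (hG : LocallyTree G h) (hπ : IsPartialEdgeColoring G π)
    (σ : Equiv.Perm V) :
    ∑ v, ∑ c, (if Retreats G π h (σ (π c (σ v))) (π c (σ v)) c then (1 : ℝ) else 0) ≤
      Fintype.card V :=
  calc _ = ∑ c, ∑ v, (if Retreats G π h (σ v) v c then (1 : ℝ) else 0) := by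
        rw [Finset.sum_comm]
        exact Finset.sum_congr rfl fun c _ =>
          Equiv.sum_comp (π c * σ) fun v => if Retreats G π h (σ v) v c then (1 : ℝ) else 0
    _ ≤ ∑ _v : V, (1 : ℝ) := by
        rw [Finset.sum_comm]
        refine Finset.sum_le_sum fun v _ => ?_
        rw [Finset.sum_boole]
        exact_mod_cast hG.card_retreats_le_one hπ (σ v) v
    _ = Fintype.card V := by simp

theorem exists_isNonbacktracking [DecidableEq V] (hG : LocallyTree G h)
    (hπ : IsPartialEdgeColoring G π) (σ : Equiv.Perm V) {M : ℕ} [NeZero M]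
    {g : V → ℝ} (hg : 0 ≤ g) {f : V → A → ℝ} (hf : 0 ≤ f)
    (hsum : Fintype.card A * ∑ v, g v + M * (∑ v, ∑ c, f v c +
      ∑ c, (Finset.univ.filter fun v => π c v = v).card + 2 * Fintype.card V) <
        Fintype.card A * Fintype.card V) :
    ∃ (u : ℕ → V) (c : ℕ → A), IsNonbacktracking G π h σ M u c ∧
      g (u 0) + ∑ i ∈ Finset.range M, f (u i) (c i) < 1 := by
  classical
  let stay (v : V) (c : A) : ℝ := if π c (σ v) = σ v then 1 else 0
  let succBack (v : V) (c : A) : ℝ :=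
    if Retreats G π h (σ (π c (σ v))) (π c (σ v)) c then 1 else 0
  let back (x v : V) (c : A) : ℝ := if Retreats G π h x (σ v) c then 1 else 0
  have hstay : ∑ v, ∑ c, stay v c =
      ∑ c, ((Finset.univ.filter fun v => π c v = v).card : ℝ) := by
    rw [Finset.sum_comm]
    refine Finset.sum_congr rfl fun c _ => ?_
    rw [Equiv.sum_comp σ fun v => if π c v = v then (1 : ℝ) else 0, Finset.sum_boole]
  have hsucc : ∑ v, ∑ c, succBack v c ≤ Fintype.card V := hG.sum_retreats_le hπ σ
  obtain ⟨u, c, hu, hlt⟩ := exists_trajectory_weight_lt_one σ π (M := M) g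
    (fun v c => f v c + (stay v c + succBack v c)) back
    (fun x v => by
      simp only [back, Finset.sum_boole]
      exact_mod_cast hG.card_retreats_le_one hπ x (σ v)) (by
      refine lt_of_le_of_lt ?_ hsum
      simp only [Finset.sum_add_distrib, hstay]
      push_cast
      gcongr _ + _ * ?_
      linarith)
  have hstay0 (v c) : 0 ≤ stay v c := by dsimp only [stay]; split_ifs <;> norm_num
  have hsucc0 (v c) : 0 ≤ succBack v c := by dsimp only [succBack]; split_ifs <;> norm_num
  have hback0 (x v c) : 0 ≤ back x v c := by dsimp only [back]; split_ifs <;> norm_num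
  have hf0 (v c) : 0 ≤ f v c := hf v c
  have hstep (i : ℕ) (hi : i < M) :
      f (u i) (c i) + (stay (u i) (c i) + succBack (u i) (c i)) + back (u 0) (u i) (c i) < 1 := by
    refine lt_of_le_of_lt (Finset.single_le_sum (f := fun i => f (u i) (c i) +
      (stay (u i) (c i) + succBack (u i) (c i)) + back (u 0) (u i) (c i)) (fun i _ => ?_)
      (Finset.mem_range.2 hi)) (lt_of_le_of_lt (le_add_of_nonneg_left (hg (u 0))) hlt)
    have := hf0 (u i) (c i); have := hstay0 (u i) (c i); have := hsucc0 (u i) (c i)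
    have := hback0 (u 0) (u i) (c i)
    positivity
  refine ⟨u, c, ⟨hu, fun i hi heq => ?_, fun i hi hret => ?_, fun i hi hret => ?_⟩, ?_⟩
  · have : stay (u i) (c i) = 1 := if_pos heq
    linarith [hstep i hi, hf0 (u i) (c i), hsucc0 (u i) (c i), hback0 (u 0) (u i) (c i)]
  · have : back (u 0) (u i) (c i) = 1 := if_pos hret
    linarith [hstep i hi, hf0 (u i) (c i), hstay0 (u i) (c i), hsucc0 (u i) (c i)]
  · rw [hu] at hret
    have : succBack (u i) (c i) = 1 := if_pos hret
    linarith [hstep i hi, hf0 (u i) (c i), hstay0 (u i) (c i), hback0 (u 0) (u i) (c i)]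
  · refine lt_of_le_of_lt ?_ hlt
    gcongr with i
    linarith [hstay0 (u i) (c i), hsucc0 (u i) (c i), hback0 (u 0) (u i) (c i)]

theorem sum_weights_lt [DecidableEq V] [Nonempty V] {M D : ℕ} [NeZero M] (S Z : Finset V)
    {f : V → A → ℝ} {b : ℝ} (hb : 0 < b)
    (hfb : 4 * (M * ∑ v, ∑ c, f v c) ≤ b * (Fintype.card A * Fintype.card V))
    (hS : 8 * Sᶜ.card ≤ Fintype.card V) (hZ : 16 * Z.card ≤ 3 * Fintype.card V)
    (hfix : ∀ c, (Finset.univ.filter fun v => π c v = v).card ≤ D)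
    (hD : 32 * (M * D) ≤ Fintype.card V) (hM : 64 * M ≤ Fintype.card A) :
    Fintype.card A * ∑ v, (if v ∈ S then (0 : ℝ) else 1) +
      M * (∑ v, ∑ c, (f v c / b + 2 / M * if v ∈ Z then 1 else 0) +
        ∑ c, (Finset.univ.filter fun v => π c v = v).card + 2 * Fintype.card V) <
      Fintype.card A * Fintype.card V := by
  have hM0 : (0 : ℝ) < M := by exact_mod_cast Nat.pos_of_neZero M
  have hA : (0 : ℝ) < Fintype.card A := by
    have := Nat.pos_of_neZero M
    exact_mod_cast (by omega : 0 < Fintype.card A)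
  have hV : (0 : ℝ) < Fintype.card V := by exact_mod_cast Fintype.card_pos
  have hstart : ∑ v, (if v ∈ S then (0 : ℝ) else 1) = Sᶜ.card := by
    simp [Finset.sum_ite, Finset.compl_eq_univ_sdiff, Finset.sdiff_eq_filter]
  have hlen : M * ∑ v, ∑ c, f v c / b ≤ Fintype.card A * Fintype.card V / 4 := by
    simp only [← Finset.sum_div]
    rw [mul_div_assoc', div_le_div_iff₀ hb (by norm_num)]
    linarith
  have hshorts : M * ∑ v, ∑ _c : A, 2 / M * (if v ∈ Z then (1 : ℝ) else 0) =
      Fintype.card A * (2 * Z.card) := by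
    simp only [Finset.sum_const, Finset.card_univ, nsmul_eq_mul, ← Finset.mul_sum,
      Finset.sum_boole, Finset.filter_univ_mem]
    field_simp
  have hfixes : ∑ c, ((Finset.univ.filter fun v => π c v = v).card : ℝ) ≤
      Fintype.card A * D := by
    rw [← nsmul_eq_mul, ← Finset.card_univ, ← Finset.sum_const]
    exact Finset.sum_le_sum fun c _ => by exact_mod_cast hfix c
  rify at hS hZ hD hM
  simp only [hstart, Finset.sum_add_distrib, mul_add, hshorts]
  push_cast
  linarith [mul_le_mul_of_nonneg_left hS hA.le, mul_le_mul_of_nonneg_left hZ hA.le,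
    mul_le_mul_of_nonneg_left hD hA.le, mul_le_mul_of_nonneg_right hM hV.le,
    mul_le_mul_of_nonneg_left hfixes hM0.le, mul_pos hA hV]

-- The weights leave room for fewer than `M / 2` short jumps and a total length of at most `b`.
theorem exists_isNonbacktracking_of_card_le [DecidableEq V] [Nonempty V] (hG : LocallyTree G h)
    (hπ : IsPartialEdgeColoring G π) (σ : Equiv.Perm V) {M R D : ℕ} [NeZero M] (S : Finset V)
    {f : V → A → ℝ} (hf : 0 ≤ f) {b : ℝ} (hb : 0 < b)
    (hfb : 4 * (M * ∑ v, ∑ c, f v c) ≤ b * (Fintype.card A * Fintype.card V))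
    (hS : 8 * Sᶜ.card ≤ Fintype.card V)
    (hshort : 16 * (Finset.univ.filter fun v => G.dist v (σ v) < R).card ≤ 3 * Fintype.card V)
    (hfix : ∀ c, (Finset.univ.filter fun v => π c v = v).card ≤ D)
    (hD : 32 * (M * D) ≤ Fintype.card V) (hM : 64 * M ≤ Fintype.card A) :
    ∃ (u : ℕ → V) (c : ℕ → A), IsNonbacktracking G π h σ M u c ∧ u 0 ∈ S ∧
      ∑ i ∈ Finset.range M, f (u i) (c i) ≤ b ∧
      2 * ((Finset.range M).filter fun i => G.dist (u i) (σ (u i)) < R).card < M := by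
  let Z := Finset.univ.filter fun v => G.dist v (σ v) < R
  have hM0 : (0 : ℝ) < M := by exact_mod_cast Nat.pos_of_neZero M
  have hshort0 (v) : 0 ≤ 2 / M * (if v ∈ Z then (1 : ℝ) else 0) :=
    mul_nonneg (by positivity) (by split_ifs <;> norm_num)
  have hfb0 (v c) : 0 ≤ f v c / b := div_nonneg (hf v c) hb.le
  obtain ⟨u, c, hu, hlt⟩ := exists_isNonbacktracking hG hπ σ
    (g := fun v => if v ∈ S then (0 : ℝ) else 1) (fun v => by dsimp only; split_ifs <;> simp)
    (fun v c => add_nonneg (hfb0 v c) (hshort0 v))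
    (sum_weights_lt S Z hb hfb hS hshort hfix hD hM)
  rw [Finset.sum_add_distrib] at hlt
  have hlen0 := Finset.sum_nonneg fun i (_ : i ∈ Finset.range M) => hfb0 (u i) (c i)
  have hshorts0 := Finset.sum_nonneg fun i (_ : i ∈ Finset.range M) => hshort0 (u i)
  have hu0 : u 0 ∈ S := by
    by_contra hu0
    rw [if_neg hu0] at hlt
    linarith
  rw [if_pos hu0, zero_add] at hlt
  refine ⟨u, c, hu, hu0, ?_, ?_⟩
  · rw [← Finset.sum_div] at hlt hlen0
    exact ((div_lt_one hb).1 (by linarith)).le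
  · have hlt' : ∑ i ∈ Finset.range M, 2 / M * (if u i ∈ Z then (1 : ℝ) else 0) < 1 := by linarith
    simp only [Z, Finset.mem_filter_univ] at hlt'
    rw [← Finset.mul_sum, Finset.sum_boole, div_mul_eq_mul_div, div_lt_one hM0] at hlt'
    exact_mod_cast hlt'

end Existence

section Distance

variable {σ : Equiv.Perm V} {M : ℕ} {u : ℕ → V} {c : ℕ → A}

theorem IsNonbacktracking.adj (hu : IsNonbacktracking G π h σ M u c)
    (hπ : IsPartialEdgeColoring G π) {i : ℕ} (hi : i < M) : G.Adj (σ (u i)) (u (i + 1)) := by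
  rw [hu.step]
  exact hπ.adj (hu.apply_ne i hi)

theorem IsNonbacktracking.sum_dist_le (hu : IsNonbacktracking G π h σ M u c)
    (hG : LocallyTree G h) (hc : G.Connected) (hπ : IsPartialEdgeColoring G π)
    (hh : ∀ i, i + 1 < M → G.dist (u 0) (σ (u i)) + G.dist (u (i + 1)) (σ (u (i + 1))) ≤ h)
    {i : ℕ} (hi : i < M) :
    ∑ j ∈ Finset.range (i + 1), G.dist (u j) (σ (u j)) ≤ G.dist (u 0) (σ (u i)) := by
  induction i with
  | zero => simp
  | succ i ih =>
    specialize ih (by omega)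
    specialize hh i hi
    have hadj := hu.adj hπ (i := i) (by omega)
    have haway : G.dist (u 0) (σ (u i)) < G.dist (u 0) (u (i + 1)) := by
      by_contra! hle
      exact hu.not_retreats i (by omega) ⟨hu.apply_ne i (by omega), by omega, by rwa [← hu.step]⟩
    have haway' : G.dist (σ (u (i + 1))) (u (i + 1)) < G.dist (σ (u (i + 1))) (σ (u i)) := by
      by_contra! hle
      have heq : π (c i) (u (i + 1)) = σ (u i) := by rw [hu.step, hπ.involutive]
      refine hu.not_retreats_succ i (by omega) ⟨heq ▸ hadj.ne, ?_, heq ▸ hle⟩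
      rw [SimpleGraph.dist_comm]
      omega
    have hone : G.dist (u 0) (u (i + 1)) ≤ G.dist (u 0) (σ (u i)) + 1 := by
      simpa [SimpleGraph.dist_eq_one_iff_adj.2 hadj] using
        hc.dist_triangle (u := u 0) (v := σ (u i)) (w := u (i + 1))
    rw [SimpleGraph.dist_comm (u := u (i + 1))] at hh
    rw [Finset.sum_range_succ, SimpleGraph.dist_comm (u := u (i + 1)),
      hG.dist_add hc hadj haway haway' (by omega)]
    omega

theorem IsNonbacktracking.dist_le (hu : IsNonbacktracking G π h σ M u c) (hc : G.Connected)
    (hπ : IsPartialEdgeColoring G π) {x : ℝ} (hx : 0 ≤ x)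
    (hdist : ∀ i < M, σ (u i) = u i ∨ (G.dist (u 0) (σ (u i)) : ℝ) ≤ x) {i : ℕ} (hi : i < M) :
    (G.dist (u 0) (σ (u i)) : ℝ) ≤ x + i := by
  induction i with
  | zero =>
    rcases hdist 0 hi with heq | hle
    · simpa [heq] using hx
    · simpa using hle
  | succ i ih =>
    rcases hdist (i + 1) hi with heq | hle
    · have hone : G.dist (u 0) (u (i + 1)) ≤ G.dist (u 0) (σ (u i)) + 1 := by
        simpa [SimpleGraph.dist_eq_one_iff_adj.2 (hu.adj hπ (i := i) (by omega))] using
          hc.dist_triangle (u := u 0) (v := σ (u i)) (w := u (i + 1))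
      rify at hone
      rw [heq]
      push_cast
      linarith [ih (by omega)]
    · exact hle.trans (le_add_of_nonneg_right (Nat.cast_nonneg _))

theorem IsNonbacktracking.mul_lt (hu : IsNonbacktracking G π h σ M u c) (hG : LocallyTree G h)
    (hc : G.Connected) (hπ : IsPartialEdgeColoring G π) {b : ℝ} {R : ℕ}
    (hjump : ∀ v, (G.dist v (σ v) : ℝ) ≤ b)
    (hdist : ∀ i < M, σ (u i) = u i ∨ (G.dist (u 0) (σ (u i)) : ℝ) ≤ 2 * b)
    (hh : 3 * b + M ≤ h)
    (hshort : 2 * ((Finset.range M).filter fun i => G.dist (u i) (σ (u i)) < R).card < M) :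
    (R : ℝ) * M < 2 * (2 * b + M) := by
  have hb : 0 ≤ b := (Nat.cast_nonneg _).trans (hjump (u 0))
  have hle (i : ℕ) (hi : i < M) := hu.dist_le hc hπ (by linarith : 0 ≤ 2 * b) hdist hi
  obtain ⟨m, rfl⟩ : ∃ m, M = m + 1 := ⟨M - 1, by omega⟩
  push_cast at hh ⊢
  have hsum := hu.sum_dist_le hG hc hπ (fun i hi => by
    have him : (i : ℝ) ≤ m := by exact_mod_cast (by omega : i ≤ m)
    have := hle i (by omega)
    have := hjump (u (i + 1))
    exact_mod_cast (by linarith :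
      (G.dist (u 0) (σ (u i)) : ℝ) + G.dist (u (i + 1)) (σ (u (i + 1))) ≤ h)) (Nat.lt_add_one m)
  have hlong : m + 1 ≤
      2 * ((Finset.range (m + 1)).filter fun i => ¬ G.dist (u i) (σ (u i)) < R).card := by
    have := Finset.card_filter_add_card_filter_not (s := Finset.range (m + 1))
      (fun i => G.dist (u i) (σ (u i)) < R)
    rw [Finset.card_range] at this
    omega
  have hR : ((Finset.range (m + 1)).filter fun i => ¬ G.dist (u i) (σ (u i)) < R).card * R ≤
      ∑ i ∈ Finset.range (m + 1), G.dist (u i) (σ (u i)) := by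
    rw [← smul_eq_mul, ← Finset.sum_const]
    refine le_trans (Finset.sum_le_sum fun i hi => ?_)
      (Finset.sum_le_sum_of_subset (Finset.filter_subset _ _))
    simpa using (Finset.mem_filter.1 hi).2
  have htotal : R * (m + 1) ≤ 2 * G.dist (u 0) (σ (u m)) := by nlinarith
  rify at htotal
  linarith [hle m (Nat.lt_add_one m)]

end Distance

end NonbacktrackingWalks

section ContractionLengths

variable {V A : Type*} [Fintype V] [DecidableEq V]

/-- The edge lengths of a graph that are induced by edge lengths `ℓ` of a contraction: the edges
inside the clusters get length `0`. -/
def pullLength (F : Finpartition (Finset.univ : Finset V)) (ℓ : Sym2 F.parts → ℝ)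
    (e : Sym2 V) : ℝ :=
  open Classical in if (e.map (clusterOf F)).IsDiag then 0 else ℓ (e.map (clusterOf F))

variable {F : Finpartition (Finset.univ : Finset V)} {ℓ : Sym2 F.parts → ℝ}

theorem pullLength_nonneg (hℓ : 0 ≤ ℓ) : 0 ≤ pullLength F ℓ := fun e => by
  rw [pullLength]
  split_ifs
  · exact le_rfl
  · exact hℓ _

theorem pullLength_eq_zero {u v : V} (huv : clusterOf F u = clusterOf F v) :
    pullLength F ℓ s(u, v) = 0 :=
  if_pos huv

theorem pullLength_of_ne {u v : V} (huv : clusterOf F u ≠ clusterOf F v) :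
    pullLength F ℓ s(u, v) = ℓ s(clusterOf F u, clusterOf F v) :=
  if_neg huv

namespace CapGraph

open Classical in
theorem sum_contract_cap (G : CapGraph V) (F : Finpartition (Finset.univ : Finset V))
    (ℓ : Sym2 F.parts → ℝ) :
    ∑ e ∈ (G.contract F).graph.edgeFinset, ((G.contract F).cap e : ℝ) * ℓ e =
      ∑ e ∈ G.graph.edgeFinset, (G.cap e : ℝ) * pullLength F ℓ e := by
  let crossing := G.graph.edgeFinset.filter fun e => ¬ (e.map (clusterOf F)).IsDiag
  have hcrossing : ∀ e ∈ crossing, e.map (clusterOf F) ∈ (G.contract F).graph.edgeFinset := by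
    intro e he
    rw [Finset.mem_filter, SimpleGraph.mem_edgeFinset] at he
    rw [SimpleGraph.mem_edgeFinset]
    induction e with
    | _ u v => exact ⟨he.2, u, v, rfl, rfl, he.1⟩
  calc ∑ e ∈ (G.contract F).graph.edgeFinset, ((G.contract F).cap e : ℝ) * ℓ e
      = ∑ e' ∈ (G.contract F).graph.edgeFinset, ∑ e ∈ crossing.filter (·.map (clusterOf F) = e'),
          (G.cap e : ℝ) * ℓ (e.map (clusterOf F)) := by
        refine Finset.sum_congr rfl fun e' he' => ?_
        have hdiag := (G.contract F).graph.not_isDiag_of_mem_edgeSet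
          (SimpleGraph.mem_edgeFinset.1 he')
        rw [CapGraph.contract, NNReal.coe_sum, Finset.sum_mul, Finset.filter_filter]
        refine Finset.sum_congr (Finset.filter_congr fun e _ => ?_) fun e he => ?_
        · exact ⟨fun h => ⟨h ▸ hdiag, h⟩, fun h => h.2⟩
        · rw [(Finset.mem_filter.1 he).2.2]
    _ = ∑ e ∈ crossing, (G.cap e : ℝ) * ℓ (e.map (clusterOf F)) :=
        Finset.sum_fiberwise_of_maps_to hcrossing _
    _ = ∑ e ∈ G.graph.edgeFinset, (G.cap e : ℝ) * pullLength F ℓ e := by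
        rw [Finset.sum_filter]
        refine Finset.sum_congr rfl fun e _ => ?_
        rw [pullLength, ite_not, mul_ite, mul_zero]

end CapGraph

/-- With edge lengths `ℓ`, some walk from `u` to `v` has length at most `x`. -/
def ReachesWithin {W : Type*} (G : SimpleGraph W) (ℓ : Sym2 W → ℝ) (u v : W) (x : ℝ) : Prop :=
  ∃ p : G.Walk u v, (p.edges.map ℓ).sum ≤ x

namespace ReachesWithin

variable {W : Type*} {G : SimpleGraph W} {ℓ : Sym2 W → ℝ} {u v w : W} {x y : ℝ}

theorem refl (G : SimpleGraph W) (ℓ : Sym2 W → ℝ) (u : W) : ReachesWithin G ℓ u u 0 :=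
  ⟨.nil, by simp⟩

theorem symm (h : ReachesWithin G ℓ u v x) : ReachesWithin G ℓ v u x := by
  obtain ⟨p, hp⟩ := h
  exact ⟨p.reverse, by simpa [List.sum_reverse] using hp⟩

theorem trans (h : ReachesWithin G ℓ u v x) (h' : ReachesWithin G ℓ v w y) :
    ReachesWithin G ℓ u w (x + y) := by
  obtain ⟨⟨p, hp⟩, ⟨q, hq⟩⟩ := And.intro h h'
  exact ⟨p.append q, by simpa using add_le_add hp hq⟩

theorem mono (h : ReachesWithin G ℓ u v x) (hxy : x ≤ y) : ReachesWithin G ℓ u v y :=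
  h.imp fun _ hp => hp.trans hxy

theorem nonneg (hℓ : 0 ≤ ℓ) (h : ReachesWithin G ℓ u v x) : 0 ≤ x := by
  obtain ⟨p, hp⟩ := h
  refine le_trans (List.sum_nonneg fun z hz => ?_) hp
  obtain ⟨e, -, rfl⟩ := List.mem_map.1 hz
  exact hℓ e

end ReachesWithin

theorem CapGraph.LengthsDominate.le_of_reachesWithin {ι : Type*} {G : CapGraph V} {τ : ι → V}
    {ℓ : Sym2 V → ℝ} (hℓ : 0 ≤ ℓ) {δ : ι → ι → ℝ} (hdom : G.LengthsDominate τ ℓ δ) {t t' : ι}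
    (hne : t ≠ t') {x : ℝ} (h : ReachesWithin G.graph ℓ (τ t) (τ t') x) : δ t t' ≤ x := by
  obtain ⟨p, hp⟩ := h
  calc δ t t' ≤ ∑ e ∈ p.bypass.edges.toFinset, ℓ e :=
        hdom t t' hne _ (CapGraph.mem_paths.2 ⟨p.bypass, p.bypass_isPath, rfl⟩)
    _ = (p.bypass.edges.map ℓ).sum :=
        List.sum_toFinset _ p.bypass_isPath.isTrail.edges_nodup
    _ ≤ (p.edges.map ℓ).sum :=
        (p.edges_bypass_sublist_edges.map ℓ).sum_le_sum fun z hz => by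
          obtain ⟨e, -, rfl⟩ := List.mem_map.1 hz
          exact hℓ e
    _ ≤ x := hp

variable {G : CapGraph V}

theorem reachesWithin_contract_of_adj {u v : V} (h : G.graph.Adj u v) :
    ReachesWithin (G.contract F).graph ℓ (clusterOf F u) (clusterOf F v)
      (pullLength F ℓ s(u, v)) := by
  by_cases huv : clusterOf F u = clusterOf F v
  · rw [pullLength_eq_zero huv, huv]
    exact .refl _ _ _
  · have hadj : (G.contract F).graph.Adj (clusterOf F u) (clusterOf F v) := ⟨huv, u, v, rfl, rfl, h⟩
    exact ⟨hadj.toWalk, by simp [pullLength_of_ne huv]⟩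

theorem reachesWithin_contract_of_walk {u v : V} (p : G.graph.Walk u v) :
    ReachesWithin (G.contract F).graph ℓ (clusterOf F u) (clusterOf F v)
      (p.edges.map (pullLength F ℓ)).sum := by
  induction p with
  | nil => exact .refl _ _ _
  | cons h p ih => simpa using (reachesWithin_contract_of_adj h).trans ih

theorem IsNonbacktracking.reachesWithin_contract {π : A → Equiv.Perm V} {h M : ℕ}
    {σ : Equiv.Perm V} {u : ℕ → V} {c : ℕ → A} (hu : IsNonbacktracking G.graph π h σ M u c)
    (hπ : IsPartialEdgeColoring G.graph π) (hσ : ∀ v, clusterOf F (σ v) = clusterOf F v)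
    {i : ℕ} (hi : i ≤ M) :
    ReachesWithin (G.contract F).graph ℓ (clusterOf F (u 0)) (clusterOf F (u i))
      (∑ j ∈ Finset.range i, pullLength F ℓ s(σ (u j), π (c j) (σ (u j)))) := by
  induction i with
  | zero => exact .refl _ _ _
  | succ i ih =>
    have hstep := reachesWithin_contract_of_adj (F := F) (ℓ := ℓ) (hu.adj hπ hi)
    rw [hσ] at hstep
    rw [Finset.sum_range_succ, ← hu.step]
    exact (ih (Nat.le_of_succ_le hi)).trans hstep

end ContractionLengths

section ColourLengths

variable {V A : Type*} [Fintype V] [Fintype A] {G : SimpleGraph V} {π : A → Equiv.Perm V}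

theorem IsPartialEdgeColoring.card_colours_edge_le_two [DecidableEq V]
    (hπ : IsPartialEdgeColoring G π) (e : Sym2 V) :
    (Finset.univ.filter fun x : V × A => π x.2 x.1 ≠ x.1 ∧ s(x.1, π x.2 x.1) = e).card ≤ 2 := by
  calc _ ≤ e.toFinset.card := by
        refine Finset.card_le_card_of_injOn Prod.fst (fun x hx => ?_) ?_
        · obtain ⟨-, rfl⟩ := (Finset.mem_filter.1 hx).2
          simp
        · rintro ⟨v, a⟩ hx ⟨_, a'⟩ hx' rfl
          obtain ⟨hne, he⟩ := (Finset.mem_filter.1 hx).2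
          obtain ⟨-, he'⟩ := (Finset.mem_filter.1 hx').2
          rw [hπ.eq_of_apply_eq a a' v (Sym2.congr_right.1 (he.trans he'.symm)) hne]
    _ ≤ 2 := by
        rw [Sym2.card_toFinset]
        split_ifs <;> omega

open Classical in
theorem IsPartialEdgeColoring.sum_sum_le (hπ : IsPartialEdgeColoring G π) {ℓ : Sym2 V → ℝ}
    (hℓ : 0 ≤ ℓ) (hdiag : ∀ v, ℓ s(v, v) = 0) :
    ∑ v, ∑ a, ℓ s(v, π a v) ≤ 2 * ∑ e ∈ G.edgeFinset, ℓ e := by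
  let moved := Finset.univ.filter fun x : V × A => π x.2 x.1 ≠ x.1
  have hmoved : ∀ x ∈ moved, s(x.1, π x.2 x.1) ∈ G.edgeFinset := fun x hx =>
    SimpleGraph.mem_edgeFinset.2 (hπ.adj (Finset.mem_filter.1 hx).2)
  calc ∑ v, ∑ a, ℓ s(v, π a v) = ∑ x ∈ moved, ℓ s(x.1, π x.2 x.1) := by
        rw [← Fintype.sum_prod_type', Finset.sum_filter_of_ne]
        rintro x - hx heq
        exact hx (by rw [heq, hdiag])
    _ = ∑ e ∈ G.edgeFinset, ∑ x ∈ moved.filter fun x => s(x.1, π x.2 x.1) = e,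
          ℓ s(x.1, π x.2 x.1) := (Finset.sum_fiberwise_of_maps_to hmoved _).symm
    _ ≤ ∑ e ∈ G.edgeFinset, 2 * ℓ e := Finset.sum_le_sum fun e _ => by
        rw [Finset.sum_congr rfl fun x hx => congrArg ℓ (Finset.mem_filter.1 hx).2,
          Finset.sum_const, nsmul_eq_mul, Finset.filter_filter]
        exact mul_le_mul_of_nonneg_right
          (by exact_mod_cast hπ.card_colours_edge_le_two e) (hℓ e)
    _ = 2 * ∑ e ∈ G.edgeFinset, ℓ e := (Finset.mul_sum _ _ _).symm

theorem IsPartialEdgeColoring.card_le_degree [DecidableRel G.Adj] (hπ : IsPartialEdgeColoring G π)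
    {v : V} (hv : ∀ a, π a v ≠ v) : Fintype.card A ≤ G.degree v := by
  rw [← Finset.card_univ, ← SimpleGraph.card_neighborFinset_eq_degree]
  refine Finset.card_le_card_of_injOn (fun a => π a v) (fun a _ => ?_)
    fun a _ a' _ h => hπ.eq_of_apply_eq a a' v h (hv a)
  simpa using hπ.adj (hv a)

end ColourLengths

section LongContractions

variable {V A : Type*} [Fintype V] [DecidableEq V] [Nonempty V] [Fintype A] {G : CapGraph V}
  {π : A → Equiv.Perm V} {F : Finpartition (Finset.univ : Finset V)} {ℓ : Sym2 F.parts → ℝ}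

open Classical in
theorem exists_isNonbacktracking_contract {h : ℕ} (hG : LocallyTree G.graph h)
    (hπ : IsPartialEdgeColoring G.graph π) (hℓ : 0 ≤ ℓ) {σ : Equiv.Perm V} {M R D : ℕ} [NeZero M]
    (S : Finset V) {b : ℝ} (hb : 0 < b)
    (hlen : 8 * (M * ∑ e ∈ G.graph.edgeFinset, pullLength F ℓ e) ≤
      b * (Fintype.card A * Fintype.card V))
    (hS : 8 * Sᶜ.card ≤ Fintype.card V)
    (hshort : 16 * (Finset.univ.filter fun v => G.graph.dist v (σ v) < R).card ≤
      3 * Fintype.card V)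
    (hfix : ∀ c, (Finset.univ.filter fun v => π c v = v).card ≤ D)
    (hD : 32 * (M * D) ≤ Fintype.card V) (hM : 64 * M ≤ Fintype.card A) :
    ∃ (u : ℕ → V) (c : ℕ → A), IsNonbacktracking G.graph π h σ M u c ∧ u 0 ∈ S ∧
      ∑ i ∈ Finset.range M, pullLength F ℓ s(σ (u i), π (c i) (σ (u i))) ≤ b ∧
      2 * ((Finset.range M).filter fun i => G.graph.dist (u i) (σ (u i)) < R).card < M := by
  refine exists_isNonbacktracking_of_card_le hG hπ σ S
    (f := fun v c => pullLength F ℓ s(σ v, π c (σ v)))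
    (fun _ _ => pullLength_nonneg hℓ _) hb (le_trans ?_ hlen) hS hshort hfix hD hM
  have hsum := hπ.sum_sum_le (pullLength_nonneg hℓ) fun _ => pullLength_eq_zero rfl
  rw [Equiv.sum_comp σ fun v => ∑ c, pullLength F ℓ s(v, π c v)]
  nlinarith [mul_le_mul_of_nonneg_left hsum (Nat.cast_nonneg (α := ℝ) M)]

open Classical in
theorem lt_sum_pullLength (hc : G.graph.Connected) {h : ℕ} (hG : LocallyTree G.graph h)
    (hπ : IsPartialEdgeColoring G.graph π) (hℓ : 0 ≤ ℓ) (S : Finset V) {b : ℝ} (hb : 0 < b)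
    (hdist : ∀ u ∈ S, ∀ v ∈ S, ∀ y,
      ReachesWithin (G.contract F).graph ℓ (clusterOf F u) (clusterOf F v) y →
        (G.graph.dist u v : ℝ) ≤ y + b)
    (hS : 8 * Sᶜ.card ≤ Fintype.card V) {M R B D : ℕ} [NeZero M]
    (hB : ∀ u, (Finset.univ.filter fun v => G.graph.dist u v < R).card ≤ B)
    (hF : 16 * (F.parts.card * B) ≤ Fintype.card V)
    (hfix : ∀ c, (Finset.univ.filter fun v => π c v = v).card ≤ D)
    (hD : 32 * (M * D) ≤ Fintype.card V) (hM : 64 * M ≤ Fintype.card A)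
    (hh : 3 * b + M ≤ h) (hR : 2 * (2 * b + M) ≤ R * M) :
    b * (Fintype.card A * Fintype.card V) <
      8 * (M * ∑ e ∈ G.graph.edgeFinset, pullLength F ℓ e) := by
  by_contra! hlen
  obtain ⟨σ, hσF, hσS, hσfix, hσnear⟩ := exists_perm_fiber_fixing_compl (clusterOf F) S
    (fun u => Finset.univ.filter fun v => G.graph.dist u v < R) hB
  simp only [Finset.mem_filter_univ, Fintype.card_coe] at hσnear
  obtain ⟨u, c, hu, hu0, hub, hushort⟩ :=
    exists_isNonbacktracking_contract hG hπ hℓ (σ := σ) (R := R) S hb hlen hS (by omega) hfix hD hM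
  refine (hu.mul_lt hG hc hπ (b := b) (fun v => ?_) (fun i hi => ?_) hh hushort).not_ge hR
  · by_cases hv : v ∈ S
    · have hreach := ReachesWithin.refl (G.contract F).graph ℓ (clusterOf F v)
      nth_rw 2 [← hσF v] at hreach
      simpa only [zero_add] using hdist v hv (σ v) (hσS v hv) 0 hreach
    · simpa [hσfix v hv] using hb.le
  · by_cases hui : u i ∈ S
    · have hreach := hu.reachesWithin_contract hπ hσF (ℓ := ℓ) hi.le
      rw [← hσF (u i)] at hreach
      have hle := (Finset.sum_le_sum_of_subset_of_nonneg (Finset.range_mono hi.le)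
        fun j _ _ => pullLength_nonneg hℓ s(σ (u j), π (c j) (σ (u j)))).trans hub
      exact .inr (by linarith [hdist _ hu0 _ (hσS _ hui) _ (hreach.mono hle)])
    · exact .inl (hσfix _ hui)

end LongContractions

section Reinforcement

variable {V : Type*} [Fintype V] [DecidableEq V] {Γ : SimpleGraph V}

/-- The graph `Γ` with capacities that let `w` units of flow pass along each of the edge sets `E u`,
for `u ∈ S`, simultaneously. -/
def reinforcedGraph (Γ : SimpleGraph V) (S : Finset V) (E : V → Finset (Sym2 V)) (w : ℝ≥0) :
    CapGraph V where
  graph := Γ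
  cap e := 1 + w * (S.filter fun u => e ∈ E u).card
  one_le_cap _ _ := le_self_add

open Classical in
theorem sum_cap_reinforcedGraph {S : Finset V} {E : V → Finset (Sym2 V)} (w : ℝ≥0)
    (hE : ∀ u ∈ S, E u ⊆ Γ.edgeFinset) (ℓ : Sym2 V → ℝ) :
    ∑ e ∈ Γ.edgeFinset, ((reinforcedGraph Γ S E w).cap e : ℝ) * ℓ e =
      ∑ e ∈ Γ.edgeFinset, ℓ e + w * ∑ u ∈ S, ∑ e ∈ E u, ℓ e := by
  have hswap : ∑ u ∈ S, ∑ e ∈ E u, ℓ e =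
      ∑ e ∈ Γ.edgeFinset, ((S.filter fun u => e ∈ E u).card : ℝ) * ℓ e := by
    rw [Finset.sum_comm' (s' := fun e => S.filter fun u => e ∈ E u) (t' := Γ.edgeFinset)
      fun u e => by
        rw [Finset.mem_filter]
        exact ⟨fun h => ⟨h, hE u h.1 h.2⟩, fun h => h.1⟩]
    simp only [Finset.sum_const, nsmul_eq_mul]
  rw [hswap, Finset.mul_sum, ← Finset.sum_add_distrib]
  refine Finset.sum_congr rfl fun e _ => ?_
  simp only [reinforcedGraph]
  push_cast
  ring

open Classical in
theorem sum_cap_reinforcedGraph_le {S : Finset V} {E : V → Finset (Sym2 V)} {w : ℝ≥0}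
    (hE : ∀ u ∈ S, E u ⊆ Γ.edgeFinset) {d r : ℕ} (hd : ∀ v, Γ.degree v ≤ d)
    (hr : ∀ u ∈ S, (E u).card ≤ r) :
    2 * ∑ e ∈ Γ.edgeFinset, ((reinforcedGraph Γ S E w).cap e : ℝ) ≤
      Fintype.card V * (d + 2 * (w * r)) := by
  have hedges : (2 : ℝ) * Γ.edgeFinset.card ≤ Fintype.card V * d := by
    have := Finset.sum_le_card_nsmul Finset.univ _ d fun v _ => hd v
    rw [Γ.sum_degrees_eq_twice_card_edges, smul_eq_mul, Finset.card_univ] at this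
    exact_mod_cast this
  have hpaths : ∑ u ∈ S, ((E u).card : ℝ) ≤ Fintype.card V * r := by
    have := (Finset.sum_le_card_nsmul S _ r hr).trans
      (Nat.mul_le_mul_right r (Finset.card_le_univ S))
    exact_mod_cast this
  have hsum := sum_cap_reinforcedGraph w hE fun _ => 1
  simp only [mul_one, Finset.sum_const, nsmul_eq_mul] at hsum
  rw [hsum]
  nlinarith [mul_le_mul_of_nonneg_left hpaths w.coe_nonneg]

end Reinforcement

section HardDemand

/-- Short paths `p u` from the vertices `u ∈ S` to terminals. -/
structure IsTerminalRouting {V : Type*} {Γ : SimpleGraph V} (S T : Finset V) (r : ℕ) (τ : V → V)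
    (p : ∀ u, Γ.Walk u (τ u)) : Prop where
  isPath : ∀ u, (p u).IsPath
  length_le : ∀ u ∈ S, (p u).length ≤ r
  mem : ∀ u ∈ S, τ u ∈ T

theorem edges_toFinset_subset_edgeFinset {V : Type*} [DecidableEq V] {Γ : SimpleGraph V}
    [Fintype Γ.edgeSet] {u v : V} (p : Γ.Walk u v) : p.edges.toFinset ⊆ Γ.edgeFinset := fun _ he =>
  SimpleGraph.mem_edgeFinset.2 (p.edges_subset_edgeSet (List.mem_toFinset.1 he))

theorem exists_isTerminalRouting {V : Type*} {Γ : SimpleGraph V} (hc : Γ.Connected)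
    {S T : Finset V} {r : ℕ} (hT : ∀ u ∈ S, ∃ t ∈ T, Γ.dist u t ≤ r) :
    ∃ (τ : V → V) (p : ∀ u, Γ.Walk u (τ u)), IsTerminalRouting S T r τ p := by
  have hnear (u : V) : ∃ t, u ∈ S → t ∈ T ∧ Γ.dist u t ≤ r := by
    by_cases hu : u ∈ S
    · exact (hT u hu).imp fun _ ht _ => ht
    · exact ⟨u, fun h => absurd h hu⟩
  choose τ hτ using hnear
  choose p hp hlen using fun u => hc.exists_path_of_dist u (τ u)
  exact ⟨τ, p, hp, fun u hu => (hlen u).trans_le (hτ u hu).2, fun u hu => (hτ u hu).1⟩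

theorem IsTerminalRouting.sum_edges {V : Type*} [DecidableEq V] {Γ : SimpleGraph V}
    {S T : Finset V} {r : ℕ} {τ : V → V} {p : ∀ u, Γ.Walk u (τ u)}
    (hp : IsTerminalRouting S T r τ p) (ℓ : Sym2 V → ℝ) (u : V) :
    ∑ e ∈ (p u).edges.toFinset, ℓ e = ((p u).edges.map ℓ).sum :=
  List.sum_toFinset _ (hp.isPath u).isTrail.edges_nodup

variable {V A : Type*} [Fintype V] [DecidableEq V] [Fintype A] {Γ : SimpleGraph V}
  {π : A → Equiv.Perm V} {S T : Finset V} {r : ℕ} {τ : V → V}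

theorem dist_le_of_reachesWithin_contract {G : CapGraph V} (hc : G.graph.Connected)
    {p : ∀ u, G.graph.Walk u (τ u)} (hp : IsTerminalRouting S T r τ p)
    {F : Finpartition (Finset.univ : Finset V)} {ℓ : Sym2 F.parts → ℝ} (hℓ : 0 ≤ ℓ)
    (hdom : (G.contract F).LengthsDominate (fun t : T => clusterOf F (t : V)) ℓ
      fun t t' => G.graph.dist (t : V) t') {u v : V} (hu : u ∈ S) (hv : v ∈ S) {y z : ℝ}
    (hpu : ((p u).edges.map (pullLength F ℓ)).sum ≤ z)
    (hpv : ((p v).edges.map (pullLength F ℓ)).sum ≤ z)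
    (huv : ReachesWithin (G.contract F).graph ℓ (clusterOf F u) (clusterOf F v) y) :
    (G.graph.dist u v : ℝ) ≤ y + (2 * z + 2 * r) := by
  have hdist (u : V) (hu : u ∈ S) : (G.graph.dist u (τ u) : ℝ) ≤ r := by
    exact_mod_cast (SimpleGraph.dist_le (p u)).trans (hp.length_le u hu)
  have hreach (u : V) (hpu : ((p u).edges.map (pullLength F ℓ)).sum ≤ z) :=
    (reachesWithin_contract_of_walk (F := F) (ℓ := ℓ) (p u)).mono hpu
  have hττ := ((hreach u hpu).symm.trans huv).trans (hreach v hpv)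
  have hterm : (G.graph.dist (τ u) (τ v) : ℝ) ≤ z + y + z := by
    by_cases heq : τ u = τ v
    · simpa [heq] using hττ.nonneg hℓ
    · exact hdom.le_of_reachesWithin hℓ (t := ⟨τ u, hp.mem u hu⟩) (t' := ⟨τ v, hp.mem v hv⟩)
        (fun h => heq (congrArg Subtype.val h)) hττ
  have htriangle : G.graph.dist u v ≤
      G.graph.dist u (τ u) + (G.graph.dist (τ u) (τ v) + G.graph.dist v (τ v)) := by
    rw [SimpleGraph.dist_comm (u := v)]
    exact hc.dist_triangle.trans (Nat.add_le_add_left hc.dist_triangle _)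
  rify at htriangle
  linarith [hdist u hu, hdist v hv]

theorem card_compl_filter_le [Nonempty V] {f : V → ℝ} (hf : 0 ≤ f) {z : ℝ} (hz : 0 < z)
    (hsum : 16 * ∑ u ∈ S, f u ≤ z * Fintype.card V) (hS : 16 * Sᶜ.card ≤ Fintype.card V) :
    8 * (S.filter fun u => f u ≤ z)ᶜ.card ≤ Fintype.card V := by
  have hmarkov : (S.filter fun u => ¬ f u ≤ z).card * z ≤ ∑ u ∈ S, f u := by
    rw [← nsmul_eq_mul]
    refine (Finset.card_nsmul_le_sum _ _ _ fun u hu => ?_).trans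
      (Finset.sum_le_sum_of_subset_of_nonneg (Finset.filter_subset _ _) fun u _ _ => hf u)
    exact (not_le.1 (Finset.mem_filter.1 hu).2).le
  have hexpensive : 16 * (S.filter fun u => ¬ f u ≤ z).card ≤ Fintype.card V := by
    have : z * (16 * (S.filter fun u => ¬ f u ≤ z).card) ≤ z * Fintype.card V := by linarith
    exact_mod_cast le_of_mul_le_mul_left this hz
  have hcompl := Finset.card_add_card_compl (S.filter fun u => f u ≤ z)
  have hsplit := S.card_filter_add_card_filter_not fun u => f u ≤ z
  have := S.card_add_card_compl
  omega

open Classical in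
theorem lt_sum_contract_cap [Nonempty V] (hc : Γ.Connected) {h : ℕ} (hΓ : LocallyTree Γ h)
    (hπ : IsPartialEdgeColoring Γ π) {p : ∀ u, Γ.Walk u (τ u)} (hp : IsTerminalRouting S T r τ p)
    {R B D : ℕ} {x : ℝ} (hx : 0 < x) (hr : 1 ≤ r) (hA : 256 * r ≤ Fintype.card A)
    (hxh : 192 * (x * r) + 10 * r ≤ h) (hxR : 64 * x + 4 ≤ R)
    (hB : ∀ u, (Finset.univ.filter fun v => Γ.dist u v < R).card ≤ B)
    (hS : 16 * Sᶜ.card ≤ Fintype.card V)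
    (hfix : ∀ a, (Finset.univ.filter fun v => π a v = v).card ≤ D)
    (hD : 128 * (r * D) ≤ Fintype.card V) {F : Finpartition (Finset.univ : Finset V)}
    (hF : 16 * (F.parts.card * B) ≤ Fintype.card V) {ℓ : Sym2 F.parts → ℝ} (hℓ : 0 ≤ ℓ) :
    let G := reinforcedGraph Γ S (fun u => (p u).edges.toFinset) (Fintype.card A / r)
    (G.contract F).LengthsDominate (fun t : T => clusterOf F (t : V)) ℓ
      (fun t t' => Γ.dist (t : V) t') →
    2 * (x * (Fintype.card V * Fintype.card A)) <
      ∑ e ∈ (G.contract F).graph.edgeFinset, ((G.contract F).cap e : ℝ) * ℓ e := by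
  intro G hdom
  by_contra! hvol
  have hr0 : (0 : ℝ) < r := by exact_mod_cast hr
  have hA0 : (0 : ℝ) < Fintype.card A := by exact_mod_cast (by omega : 0 < Fintype.card A)
  have hpull := pullLength_nonneg (F := F) hℓ
  let cost (u : V) : ℝ := ((p u).edges.map (pullLength F ℓ)).sum
  have hcost0 : 0 ≤ cost := fun u => by
    simp only [cost, ← hp.sum_edges]
    exact Finset.sum_nonneg fun e _ => hpull e
  have hsplit : ∑ e ∈ Γ.edgeFinset, pullLength F ℓ e +
      Fintype.card A / r * ∑ u ∈ S, cost u ≤ 2 * (x * (Fintype.card V * Fintype.card A)) := by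
    rw [CapGraph.sum_contract_cap] at hvol
    have := sum_cap_reinforcedGraph (S := S) (Fintype.card A / r)
      (fun u _ => edges_toFinset_subset_edgeFinset (p u)) (pullLength F ℓ)
    simp only [hp.sum_edges] at this
    push_cast at this
    exact this.symm.trans_le hvol
  have hedges : ∑ e ∈ Γ.edgeFinset, pullLength F ℓ e ≤
      2 * (x * (Fintype.card V * Fintype.card A)) :=
    (le_add_of_nonneg_right (mul_nonneg (by positivity)
      (Finset.sum_nonneg fun u _ => hcost0 u))).trans hsplit
  have hcosts : 16 * ∑ u ∈ S, cost u ≤ 32 * (x * r) * Fintype.card V := by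
    have hle := (le_add_of_nonneg_left (Finset.sum_nonneg fun e _ => hpull e)).trans hsplit
    rw [div_mul_eq_mul_div, div_le_iff₀ hr0] at hle
    refine le_of_mul_le_mul_left ?_ hA0
    linarith
  have hcheap := card_compl_filter_le hcost0 (by positivity) hcosts hS
  have : NeZero (4 * r) := ⟨by omega⟩
  have hlong := lt_sum_pullLength (G := G) (M := 4 * r) (R := R) hc hΓ hπ hℓ
    (S.filter fun u => cost u ≤ 32 * (x * r)) (b := 2 * (32 * (x * r)) + 2 * r) (by positivity)
    (fun u hu v hv y => by
      rw [Finset.mem_filter] at hu hv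
      exact dist_le_of_reachesWithin_contract hc hp hℓ hdom hu.1 hv.1 hu.2 hv.2)
    hcheap hB hF hfix (by linarith) (by linarith) (by push_cast; linarith)
    (by push_cast; nlinarith [mul_le_mul_of_nonneg_right hxR hr0.le])
  push_cast at hlong
  change _ < 8 * (4 * r * ∑ e ∈ Γ.edgeFinset, pullLength F ℓ e) at hlong
  have hV0 : (0 : ℝ) < Fintype.card V := by exact_mod_cast Fintype.card_pos
  linarith [mul_le_mul_of_nonneg_left hedges hr0.le, mul_pos (mul_pos hr0 hA0) hV0]

open Classical in
theorem exists_demand_of_contract [Nonempty V] (hc : Γ.Connected) {h : ℕ} (hΓ : LocallyTree Γ h)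
    (hπ : IsPartialEdgeColoring Γ π) (hdeg : ∀ v, Γ.degree v ≤ 2 + Fintype.card A)
    {p : ∀ u, Γ.Walk u (τ u)} (hp : IsTerminalRouting S T r τ p)
    {R B D : ℕ} {x : ℝ} (hx : 0 < x) (hr : 1 ≤ r) (hA : 256 * r ≤ Fintype.card A)
    (hxh : 192 * (x * r) + 10 * r ≤ h) (hxR : 64 * x + 4 ≤ R)
    (hB : ∀ u, (Finset.univ.filter fun v => Γ.dist u v < R).card ≤ B)
    (hS : 16 * Sᶜ.card ≤ Fintype.card V)
    (hfix : ∀ a, (Finset.univ.filter fun v => π a v = v).card ≤ D)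
    (hD : 128 * (r * D) ≤ Fintype.card V) (F : Finpartition (Finset.univ : Finset V))
    (hF : 16 * (F.parts.card * B) ≤ Fintype.card V) :
    let G := reinforcedGraph Γ S (fun u => (p u).edges.toFinset) (Fintype.card A / r)
    ∃ D : Demand T, ENNReal.ofReal x ≤ G.cong (fun t : T => (t : V)) D ∧
      (G.contract F).cong (fun t : T => clusterOf F (t : V)) D ≤ 3 := by
  intro G
  have hcap : ∑ e ∈ G.graph.edgeFinset, (G.cap e : ℝ) ≤
      2 * (Fintype.card V * Fintype.card A) := by
    have hle := sum_cap_reinforcedGraph_le (w := Fintype.card A / r)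
      (fun u _ => edges_toFinset_subset_edgeFinset (p u)) hdeg fun u hu =>
        (List.toFinset_card_le _).trans ((p u).length_edges.trans_le (hp.length_le u hu))
    have hwr : ((Fintype.card A / r : ℝ≥0) : ℝ) * r = Fintype.card A := by
      push_cast
      exact div_mul_cancel₀ _ (by positivity)
    have hA1 : (256 : ℝ) ≤ Fintype.card A := by exact_mod_cast (by omega : 256 ≤ Fintype.card A)
    rw [hwr] at hle
    push_cast at hle
    change 2 * ∑ e ∈ G.graph.edgeFinset, (G.cap e : ℝ) ≤ _ at hle
    nlinarith [Nat.cast_nonneg (α := ℝ) (Fintype.card V)]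
  rcases CapGraph.exists_demand_or_exists_lengths (G.contract F) (fun t : T => clusterOf F (t : V))
    (δ := fun t t' => G.graph.dist (t : V) t') (fun _ _ => Nat.cast_nonneg _) (fun _ => by simp)
    (κ := 3) three_pos (v := 2 * x * ∑ e ∈ G.graph.edgeFinset, (G.cap e : ℝ)) (by positivity) with
    ⟨D, hD3, hDx⟩ | ⟨ℓ, hℓ, hvol, hdom⟩
  · refine ⟨D, ?_, hD3⟩
    refine CapGraph.ofReal_le_cong Subtype.val_injective zero_le_one G.lengthsDominate_one_dist ?_
    simpa only [Pi.one_apply, mul_one] using hDx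
  · have hlt := lt_sum_contract_cap hc hΓ hπ hp hx hr hA hxh hxR hB hS hfix hD hF hℓ hdom
    push_cast at hvol
    have hnonneg : 0 ≤ x * (Fintype.card V * Fintype.card A) := by positivity
    linarith [mul_le_mul_of_nonneg_left hcap hx.le]

end HardDemand

section Parameters

variable {V A : Type*} [Fintype V] [Fintype A] {Γ : SimpleGraph V} {π : A → Equiv.Perm V}

theorem card_le_of_forall_exists_dist_le [DecidableEq V] {U : Finset V} {ρ B D : ℕ}
    (hU : ∀ u ∈ U, ∃ v, Γ.dist u v ≤ ρ ∧ ∃ a, π a v = v)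
    (hB : ∀ u, (Finset.univ.filter fun v => Γ.dist u v ≤ ρ).card ≤ B)
    (hfix : ∀ a, (Finset.univ.filter fun v => π a v = v).card ≤ D) :
    U.card ≤ Fintype.card A * (D * B) := by
  let near (a : A) : Finset V := (Finset.univ.filter fun v => π a v = v).biUnion
    fun v => Finset.univ.filter fun u => Γ.dist v u ≤ ρ
  have hsub : U ⊆ Finset.univ.biUnion near := by
    intro u hu
    obtain ⟨v, hv, a, ha⟩ := hU u hu
    simp only [near, Finset.mem_biUnion, Finset.mem_filter_univ, Finset.mem_univ, true_and]
    exact ⟨a, v, ha, by rwa [SimpleGraph.dist_comm]⟩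
  have hnear (a : A) : (near a).card ≤ D * B :=
    (Finset.card_biUnion_le_card_mul _ _ B fun v _ => hB v).trans (Nat.mul_le_mul_right B (hfix a))
  exact (Finset.card_le_card hsub).trans
    (Finset.card_biUnion_le_card_mul _ _ _ fun a _ => hnear a)

theorem LocallyTree.pow_card_sub_one_le_card_ball {h ρ : ℕ} (hΓ : LocallyTree Γ h)
    (hπ : IsPartialEdgeColoring Γ π) [Nonempty A] (hρ : ρ ≤ h) {u : V}
    (hu : ∀ v, Γ.dist u v ≤ ρ → ∀ a, π a v ≠ v) :
    (Fintype.card A - 1) ^ ρ ≤ (Finset.univ.filter fun v => Γ.dist u v ≤ ρ).card := by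
  classical
  refine (hΓ.pow_le_card_sphere u hρ fun v hv => ?_).trans
    (Finset.card_le_card (Finset.monotone_filter_right _ fun v _ => le_of_eq))
  rw [Nat.sub_add_cancel Fintype.card_pos]
  exact hπ.card_le_degree (hu v hv.le)

theorem degree_pathGraph_le_two (n : ℕ) (v : Fin n)
    [Fintype ((SimpleGraph.pathGraph n).neighborSet v)] :
    (SimpleGraph.pathGraph n).degree v ≤ 2 := by
  rw [← SimpleGraph.card_neighborFinset_eq_degree]
  calc _ ≤ ({(v : ℕ) - 1, (v : ℕ) + 1} : Finset ℕ).card := by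
        refine Finset.card_le_card_of_injOn Fin.val (fun w hw => ?_) Fin.val_injective.injOn
        simp only [SimpleGraph.coe_neighborFinset, SimpleGraph.mem_neighborSet,
          SimpleGraph.pathGraph_adj, Finset.coe_insert, Finset.coe_singleton,
          Set.mem_insert_iff, Set.mem_singleton_iff] at hw ⊢
        omega
    _ ≤ 2 := Finset.card_le_two

open Classical in
theorem exists_capGraph_of_parameters [DecidableEq V] [Nonempty V] {G₀ : SimpleGraph V}
    (hG₀ : G₀.Connected) (hacyclic : G₀.IsAcyclic) (hdeg₀ : ∀ v, G₀.degree v ≤ 2)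
    {Δ h ρ k : ℕ} {x : ℝ} (hρ : 1 ≤ ρ) (hx : 1 ≤ x) (hρΔ : 512 * ρ ≤ Δ)
    (hxh : 384 * (x * ρ) + 20 * ρ ≤ h)
    (hhV : 32 * (Δ * (Δ + 3) ^ (2 * h + 1 + ρ)) ≤ Fintype.card V)
    (hk : Fintype.card V ≤ (Δ - 1) ^ ρ * k) (hkV : k ≤ Fintype.card V) :
    ∃ (G : CapGraph V) (T : Finset V), G.graph.Connected ∧ T.card = k ∧
      ∀ (F : Finpartition (Finset.univ : Finset V)) (R : ℕ), 64 * x + 4 ≤ R →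
        16 * (F.parts.card * (Δ + 3) ^ R) ≤ Fintype.card V →
        ∃ D : Demand T, ENNReal.ofReal x ≤ G.cong (fun t : T => (t : V)) D ∧
          (G.contract F).cong (fun t : T => clusterOf F (t : V)) D ≤ 3 := by
  obtain ⟨π, hπ, hfix⟩ := exists_isSparseMatching (A := Fin Δ) hG₀ (g := 2 * h + 1) (by omega)
    (by simp only [SimpleGraph.egirth_eq_top.2 hacyclic, ENat.natCast_lt_top]) hdeg₀
  set Γ := graphSupMatchings G₀ π
  have hcol : IsPartialEdgeColoring Γ π := hπ.isPartialEdgeColoring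
  have hc : Γ.Connected := connected_graphSupMatchings hG₀ π
  have hΓ : LocallyTree Γ h := locallyTree_of_lt_egirth hc hπ.lt_egirth
  have hdeg (v : V) : Γ.degree v ≤ 2 + Fintype.card (Fin Δ) :=
    (degree_graphSupMatchings_le hπ.involutive v).trans (by gcongr; exact hdeg₀ v)
  have hball := card_ball_le hc hdeg
  rw [Fintype.card_fin, show 2 + Δ + 1 = Δ + 3 by ring] at hball hfix
  have hρh : ρ ≤ h := by
    have h1 : (1 : ℝ) ≤ ρ := by exact_mod_cast hρ
    have : (ρ : ℝ) ≤ h := by nlinarith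
    exact_mod_cast this
  let S : Finset V := Finset.univ.filter fun u => ∀ v, Γ.dist u v ≤ ρ → ∀ a, π a v ≠ v
  have hS : 16 * Sᶜ.card ≤ Fintype.card V := by
    have hle := card_le_of_forall_exists_dist_le (U := Sᶜ) (π := π)
      (fun u hu => by simpa [S] using hu) (fun u => hball u ρ) hfix
    rw [Fintype.card_fin, ← pow_add] at hle
    omega
  have : NeZero Δ := ⟨by omega⟩
  have hballS (u : V) (hu : u ∈ S) :=
    hΓ.pow_card_sub_one_le_card_ball hcol hρh (Finset.mem_filter.1 hu).2
  rw [Fintype.card_fin] at hballS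
  obtain ⟨T, hT, hdom⟩ := exists_dominating_finset hc S (pow_pos (by omega) ρ) hballS hk hkV
  obtain ⟨τ, p, hp⟩ := exists_isTerminalRouting hc hdom
  refine ⟨reinforcedGraph Γ S (fun u => (p u).edges.toFinset) (Fintype.card (Fin Δ) / (2 * ρ : ℕ)),
    T, hc, hT, fun F R hR hF => ?_⟩
  have hball_lt (u : V) : (Finset.univ.filter fun v => Γ.dist u v < R).card ≤ (Δ + 3) ^ R :=
    (Finset.card_le_card (Finset.monotone_filter_right _ fun v _ => le_of_lt)).trans (hball u R)
  have hfixV : 128 * (2 * ρ * (Δ + 3) ^ (2 * h + 1)) ≤ Fintype.card V := by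
    refine le_trans ?_ hhV
    calc 128 * (2 * ρ * (Δ + 3) ^ (2 * h + 1))
        = 32 * ((8 * ρ) * (Δ + 3) ^ (2 * h + 1)) := by ring
      _ ≤ 32 * (Δ * (Δ + 3) ^ (2 * h + 1 + ρ)) := by gcongr <;> omega
  exact exists_demand_of_contract hc hΓ hcol hdeg hp (by linarith) (by omega)
    (by rw [Fintype.card_fin]; omega) (by push_cast; linarith) hR hball_lt hS hfix hfixV F hF

end Parameters

theorem le_two_pow_ceil_logb {l : ℝ} (hl : 0 < l) : l ≤ 2 ^ ⌈Real.logb 2 l⌉₊ := by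
  rw [← Real.rpow_natCast]
  calc l = (2 : ℝ) ^ Real.logb 2 l := (Real.rpow_logb two_pos (by norm_num) hl).symm
    _ ≤ _ := Real.rpow_le_rpow_of_exponent_le one_le_two (Nat.le_ceil _)

theorem le_two_pow_mul_floor_div {n y : ℝ} {p : ℕ} (hn : 2 ^ y ≤ n) (hy : y + 1 ≤ p) :
    n ≤ 2 ^ p * ⌊n / 2 ^ y⌋₊ := by
  have h2y : (0 : ℝ) < 2 ^ y := Real.rpow_pos_of_pos two_pos y
  have hfloor : n / 2 ^ y ≤ 2 * ⌊n / 2 ^ y⌋₊ := by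
    have hone : (1 : ℝ) ≤ ⌊n / 2 ^ y⌋₊ := by
      exact_mod_cast Nat.one_le_floor_iff _ |>.2 ((one_le_div h2y).2 hn)
    linarith [Nat.lt_floor_add_one (n / 2 ^ y)]
  have hpow : (2 : ℝ) ^ y * 2 ≤ 2 ^ p := by
    rw [← Real.rpow_add_one two_ne_zero, ← Real.rpow_natCast]
    exact Real.rpow_le_rpow_of_exponent_le one_le_two hy
  calc n = 2 ^ y * (n / 2 ^ y) := (mul_div_cancel₀ n h2y.ne').symm
    _ ≤ 2 ^ y * (2 * ⌊n / 2 ^ y⌋₊) := by gcongr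
    _ = 2 ^ y * 2 * ⌊n / 2 ^ y⌋₊ := (mul_assoc _ _ _).symm
    _ ≤ _ := by gcongr

theorem sixteen_mul_two_pow_le {m p : ℕ} {n C y : ℝ} (hn : 0 ≤ n) (hm : m ≤ C * (n / 2 ^ y))
    (hy : 4 + Real.logb 2 (max C 1) + p ≤ y) : 16 * (m * 2 ^ p) ≤ n := by
  have hC : 0 < max C 1 := lt_max_of_lt_right one_pos
  have h2y : (0 : ℝ) < 2 ^ y := Real.rpow_pos_of_pos two_pos y
  have hpow : 16 * (max C 1 * 2 ^ p) ≤ 2 ^ y := by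
    calc 16 * (max C 1 * 2 ^ p) = 2 ^ (4 + Real.logb 2 (max C 1) + p) := by
          rw [Real.rpow_add two_pos, Real.rpow_add two_pos,
            Real.rpow_logb two_pos (by norm_num) hC, Real.rpow_natCast]
          norm_num
          ring
      _ ≤ _ := Real.rpow_le_rpow_of_exponent_le one_le_two hy
  calc 16 * (m * 2 ^ p) ≤ 16 * (max C 1 * (n / 2 ^ y) * 2 ^ p) := by
        gcongr
        exact hm.trans (by gcongr; exact le_max_left C 1)
    _ = 16 * (max C 1 * 2 ^ p) * (n / 2 ^ y) := by ring
    _ ≤ 2 ^ y * (n / 2 ^ y) := by gcongr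
    _ = n := mul_div_cancel₀ n h2y.ne'

theorem eventually_logb_add_le (a : ℝ) {η δ : ℝ} (hη : 0 < η) (hδ : 0 < δ) :
    ∀ᶠ l : ℝ in Filter.atTop, Real.logb 2 l + a ≤ η * l ^ δ := by
  have hlog2 : 0 < Real.log 2 := Real.log_pos one_lt_two
  have hlog := (isLittleO_log_rpow_atTop hδ).def (c := η / 2 * Real.log 2) (by positivity)
  have ha := ((tendsto_rpow_atTop hδ).const_mul_atTop (half_pos hη)).eventually_ge_atTop a
  filter_upwards [hlog, ha, Filter.eventually_gt_atTop 0] with l hlogl hal hl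
  rw [Real.norm_of_nonneg (Real.rpow_nonneg hl.le δ)] at hlogl
  have hhalf : Real.logb 2 l ≤ η / 2 * l ^ δ := by
    rw [Real.logb, div_le_iff₀ hlog2, mul_right_comm]
    exact (Real.le_norm_self _).trans hlogl
  linarith

theorem eventually_add_logb_mul_rpow_le (a b : ℝ) {c γ β : ℝ} (hc : 0 < c) (hγ : 0 ≤ γ)
    (hβ : γ < β) :
    ∀ᶠ l : ℝ in Filter.atTop, a + (Real.logb 2 l + b) * (c * l ^ γ) ≤ l ^ β := by
  filter_upwards [eventually_logb_add_le b (η := 1 / (2 * c)) (by positivity) (sub_pos.2 hβ),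
    (tendsto_rpow_atTop (hγ.trans_lt hβ)).eventually_ge_atTop (2 * a),
    Filter.eventually_gt_atTop 0] with l hlog ha hl
  have hβγ : l ^ β = l ^ (β - γ) * l ^ γ := by rw [← Real.rpow_add hl, sub_add_cancel]
  have hprod : (Real.logb 2 l + b) * (c * l ^ γ) ≤ l ^ β / 2 := by
    calc _ ≤ 1 / (2 * c) * l ^ (β - γ) * (c * l ^ γ) := by gcongr
      _ = l ^ β / 2 := by rw [hβγ]; field_simp
  linarith

theorem exists_exponents {l L x : ℝ} (hl : 10 ≤ l) (hx : 1 ≤ x) (hL : Real.logb 2 l + 11 ≤ L)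
    (hxL : 10000 * (x * L) = l) :
    ∃ s ρ h : ℕ, 2 ≤ s ∧ s ≤ Real.logb 2 l + 11 ∧ 1 ≤ ρ ∧ 512 * ρ ≤ 2 ^ s ∧ L + 1 ≤ s * ρ ∧
      384 * (x * ρ) + 20 * ρ ≤ h ∧ 5 + (s + 1) * (2 * h + 2 + ρ) ≤ l := by
  have hlog : 0 ≤ Real.logb 2 l := Real.logb_nonneg one_lt_two (by linarith)
  have hL0 : 0 < L := by linarith
  obtain ⟨s, hs10, hsl, h2s⟩ : ∃ s : ℕ, (10 : ℝ) ≤ s ∧ s ≤ Real.logb 2 l + 11 ∧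
      1024 * l ≤ 2 ^ s := by
    refine ⟨⌈Real.logb 2 l⌉₊ + 10, ?_, ?_, ?_⟩
    · push_cast
      linarith [Nat.cast_nonneg (α := ℝ) ⌈Real.logb 2 l⌉₊]
    · push_cast
      linarith [Nat.ceil_lt_add_one hlog]
    · rw [pow_add]
      linarith [le_two_pow_ceil_logb (l := l) (by linarith)]
  obtain ⟨ρ, hρ, hLρ, hρL⟩ : ∃ ρ : ℕ, (1 : ℝ) ≤ ρ ∧ L + 1 ≤ s * ρ ∧ s * ρ ≤ 3 * L := by
    refine ⟨⌈(L + 1) / s⌉₊, ?_, ?_, ?_⟩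
    · exact_mod_cast Nat.one_le_ceil_iff.2 (by positivity)
    · rw [← div_le_iff₀' (by linarith)]
      exact Nat.le_ceil _
    · have hceil := Nat.ceil_lt_add_one (a := (L + 1) / s) (by positivity)
      rw [div_add_one (by positivity), lt_div_iff₀' (by linarith)] at hceil
      linarith
  obtain ⟨h, hle_h, hh_le⟩ : ∃ h : ℕ, 384 * (x * ρ) + 20 * ρ ≤ h ∧
      h ≤ 384 * (x * ρ) + 20 * ρ + 1 :=
    ⟨_, Nat.le_ceil _, (Nat.ceil_lt_add_one (by positivity)).le⟩
  have hρl : (ρ : ℝ) ≤ l := by nlinarith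
  have hρx : (ρ : ℝ) ≤ x * ρ := le_mul_of_one_le_left (by linarith) hx
  have hexp : (s + 1) * (2 * h + 2 + ρ) ≤ 2 * s * (813 * (x * ρ)) :=
    mul_le_mul (by linarith) (by linarith) (by positivity) (by positivity)
  have hxρ : x * (s * ρ) ≤ x * (3 * L) := mul_le_mul_of_nonneg_left hρL (by linarith)
  refine ⟨s, ρ, h, ?_, hsl, by exact_mod_cast hρ, ?_, hLρ, hle_h, by linarith⟩
  · exact_mod_cast (by linarith : (2 : ℝ) ≤ s)
  · exact_mod_cast (by linarith : (512 : ℝ) * ρ ≤ 2 ^ s)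

open Classical in
theorem exists_capGraph_of_exponents {n s ρ h k : ℕ} {x : ℝ} (hn : 0 < n) (hs : 2 ≤ s)
    (hρ : 1 ≤ ρ) (hx : 1 ≤ x) (hρs : 512 * ρ ≤ 2 ^ s) (hxh : 384 * (x * ρ) + 20 * ρ ≤ h)
    (hhn : 2 ^ (5 + (s + 1) * (2 * h + 2 + ρ)) ≤ n) (hk : n ≤ 2 ^ (s * ρ) * k) (hkn : k ≤ n) :
    ∃ (G : CapGraph (Fin n)) (T : Finset (Fin n)), G.graph.Connected ∧ T.card = k ∧
      ∀ (F : Finpartition (Finset.univ : Finset (Fin n))) (R : ℕ), 64 * x + 4 ≤ R →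
        16 * (F.parts.card * 2 ^ ((s + 1) * R)) ≤ n →
        ∃ D : Demand T, ENNReal.ofReal x ≤ G.cong (fun t : T => (t : Fin n)) D ∧
          (G.contract F).cong (fun t : T => clusterOf F (t : Fin n)) D ≤ 3 := by
  have : Nonempty (Fin n) := ⟨⟨0, hn⟩⟩
  obtain ⟨m, rfl⟩ := Nat.exists_eq_succ_of_ne_zero hn.ne'
  have hdegree : 2 ^ s + 1 + 3 ≤ 2 ^ (s + 1) := by
    have := Nat.pow_le_pow_right two_pos hs
    rw [pow_succ]
    omega
  have hsize : 32 * ((2 ^ s + 1) * (2 ^ s + 1 + 3) ^ (2 * h + 1 + ρ)) ≤ m + 1 := by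
    refine le_trans ?_ hhn
    calc _ ≤ 32 * (2 ^ (s + 1) * (2 ^ (s + 1)) ^ (2 * h + 1 + ρ)) := by gcongr; omega
      _ = _ := by rw [← pow_mul]; ring
  obtain ⟨G, T, hG, hT, hD⟩ := exists_capGraph_of_parameters (SimpleGraph.pathGraph_connected m)
    (isAcyclic_pathGraph _) (fun v => degree_pathGraph_le_two _ v) (Δ := 2 ^ s + 1) (k := k) hρ hx
    (by omega) hxh (by rwa [Fintype.card_fin])
    (by rwa [Fintype.card_fin, Nat.add_sub_cancel, ← pow_mul]) (by rwa [Fintype.card_fin])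
  refine ⟨G, T, hG, hT, fun F R hR hF => hD F R hR ?_⟩
  rw [Fintype.card_fin]
  refine le_trans ?_ hF
  rw [pow_mul]
  gcongr

theorem exists_capGraph_of_logb {n : ℕ} {L x : ℝ} (hn : 10 ≤ Real.logb 2 n) (hx : 1 ≤ x)
    (hL : Real.logb 2 (Real.logb 2 n) + 11 ≤ L) (hxL : 10000 * (x * L) = Real.logb 2 n) :
    ∃ (G : CapGraph (Fin n)) (T : Finset (Fin n)), G.graph.Connected ∧
      T.card = ⌊(n : ℝ) / (2 : ℝ) ^ L⌋₊ ∧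
      ∀ (C y : ℝ), 4 + Real.logb 2 (max C 1) +
          (Real.logb 2 (Real.logb 2 n) + 12) * (69 * x) ≤ y →
        ∀ F : Finpartition (Finset.univ : Finset (Fin n)),
          (F.parts.card : ℝ) ≤ C * ((n : ℝ) / (2 : ℝ) ^ y) →
          ∃ D : Demand T, ENNReal.ofReal x ≤ G.cong (fun t : T => (t : Fin n)) D ∧
            (G.contract F).cong (fun t : T => clusterOf F (t : Fin n)) D ≤ 3 := by
  have hn0 : 0 < n := Nat.pos_of_ne_zero fun h => by
    rw [h, Nat.cast_zero, Real.logb_zero] at hn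
    linarith
  have hnl : (2 : ℝ) ^ Real.logb 2 n = n :=
    Real.rpow_logb two_pos (by norm_num) (by exact_mod_cast hn0)
  have hL0 : 0 ≤ L := by linarith [Real.logb_nonneg one_lt_two (by linarith : 1 ≤ Real.logb 2 n)]
  obtain ⟨s, ρ, h, hs, hsl, hρ, hρs, hLρ, hxh, hexp⟩ := exists_exponents hn hx hL hxL
  have hhn : 2 ^ (5 + (s + 1) * (2 * h + 2 + ρ)) ≤ n := by
    have hle := Real.rpow_le_rpow_of_exponent_le one_le_two hexp
    rw [hnl] at hle
    exact_mod_cast hle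
  have h2L : (2 : ℝ) ^ L ≤ n := by
    rw [← hnl]
    exact Real.rpow_le_rpow_of_exponent_le one_le_two (by nlinarith)
  have hkn : ⌊(n : ℝ) / 2 ^ L⌋₊ ≤ n := by
    refine Nat.floor_le_of_le ?_
    exact div_le_self (Nat.cast_nonneg n) (Real.one_le_rpow one_le_two hL0)
  obtain ⟨G, T, hG, hT, hD⟩ := exists_capGraph_of_exponents hn0 hs hρ hx hρs hxh hhn
    (by exact_mod_cast le_two_pow_mul_floor_div (p := s * ρ) h2L (by exact_mod_cast hLρ)) hkn
  refine ⟨G, T, hG, hT, fun C y hy F hF => hD F ⌈64 * x + 4⌉₊ (Nat.le_ceil _) ?_⟩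
  have hR : (s + 1) * ⌈64 * x + 4⌉₊ ≤ (Real.logb 2 (Real.logb 2 n) + 12) * (69 * x) :=
    mul_le_mul (by linarith) (by linarith [Nat.ceil_lt_add_one (a := 64 * x + 4) (by linarith)])
      (Nat.cast_nonneg _) (by linarith [Nat.cast_nonneg (α := ℝ) s])
  exact_mod_cast sixteen_mul_two_pow_le (p := (s + 1) * ⌈64 * x + 4⌉₊) (Nat.cast_nonneg n) hF
    (by push_cast; linarith)

theorem eventually_scale {α : ℝ} (hα0 : 0 < α) (hα1 : α < 1) :
    ∀ᶠ l : ℝ in Filter.atTop,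
      10 ≤ l ∧ 10000 ≤ l ^ (1 - α) ∧ Real.logb 2 l + 11 ≤ l ^ α := by
  filter_upwards [Filter.eventually_ge_atTop (10 : ℝ),
    (tendsto_rpow_atTop (sub_pos.2 hα1)).eventually_ge_atTop 10000,
    eventually_logb_add_le 11 one_pos hα0] with l hl hlα hlog
  exact ⟨hl, hlα, by rwa [one_mul] at hlog⟩

theorem theorem3p1_general {α β : ℝ} (hα0 : 0 < α) (hα1 : α < 1) (hαβ : 1 - α < β) :
    ∃ c : ℝ, 0 < c ∧ ∃ (n₀ : ℕ) (N : ℝ → ℕ), ∀ n : ℕ, n₀ ≤ n →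
      ∃ (G : CapGraph (Fin n)) (T : Finset (Fin n)),
        G.graph.Connected ∧
        T.card = ⌊(n : ℝ) / (2 : ℝ) ^ ((Real.logb 2 n) ^ α)⌋₊ ∧
        ∀ C : ℝ, N C ≤ n →
          ∀ F : Finpartition (Finset.univ : Finset (Fin n)),
            (F.parts.card : ℝ) ≤ C * ((n : ℝ) / (2 : ℝ) ^ ((Real.logb 2 n) ^ β)) →
              ∃ D : Demand T,
                ENNReal.ofReal (c * (Real.logb 2 n) ^ (1 - α)) ≤
                  G.cong (fun t : T => (t : Fin n)) D ∧
                (G.contract F).cong (fun t : T => clusterOf F (t : Fin n)) D ≤ 3 := by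
  have hlog : Filter.Tendsto (fun n : ℕ => Real.logb 2 n) Filter.atTop Filter.atTop :=
    (Real.tendsto_logb_atTop one_lt_two).comp tendsto_natCast_atTop_atTop
  obtain ⟨n₀, hn₀⟩ := Filter.eventually_atTop.1 (hlog.eventually (eventually_scale hα0 hα1))
  choose N hN using fun C : ℝ => Filter.eventually_atTop.1 <| hlog.eventually <|
    eventually_add_logb_mul_rpow_le (4 + Real.logb 2 (max C 1)) 12 (c := 69 / 10000) (by norm_num)
      (sub_nonneg.2 hα1.le) hαβ
  refine ⟨1 / 10000, by norm_num, n₀, N, fun n hn => ?_⟩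
  obtain ⟨hl, hlα, hloglog⟩ := hn₀ n hn
  have hprod : 10000 * (1 / 10000 * Real.logb 2 n ^ (1 - α) * Real.logb 2 n ^ α) =
      Real.logb 2 n := by
    rw [mul_assoc, ← Real.rpow_add (by linarith), sub_add_cancel, Real.rpow_one]
    ring
  obtain ⟨G, T, hG, hT, hD⟩ := exists_capGraph_of_logb hl (by linarith) hloglog hprod
  refine ⟨G, T, hG, hT, fun C hC F hF => hD C _ ((hN C n hC).trans' (le_of_eq ?_)) F hF⟩
  ring

theorem exponent_bounds {ε α β : ℝ} (hε0 : 0 < ε) (hε1 : ε < 1)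
    (hα : α = Real.logb 2 5 / (Real.logb 2 5 + 1 - ε))
    (hβ : β = (Real.logb 2 5 - 0.5 * ε) / (Real.logb 2 5 + 1 - ε)) :
    0 < α ∧ α < 1 ∧ 1 - α < β := by
  have h5 : 2 < Real.logb 2 5 := by
    rw [Real.lt_logb_iff_rpow_lt one_lt_two (by norm_num)]
    norm_num
  have hden : 0 < Real.logb 2 5 + 1 - ε := by linarith
  rw [hα, hβ, one_sub_div hden.ne', div_lt_div_iff_of_pos_right hden, div_lt_one hden]
  exact ⟨div_pos (by linarith) hden, by linarith, by linarith⟩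

theorem theorem3p1 (ε α β : ℝ) (hε0 : 0 < ε) (hε1 : ε < 1)
    (hα : α = Real.logb 2 5 / (Real.logb 2 5 + 1 - ε))
    (hβ : β = (Real.logb 2 5 - 0.5 * ε) / (Real.logb 2 5 + 1 - ε)) :
    ∃ c : ℝ, 0 < c ∧ ∃ (n₀ : ℕ) (N : ℝ → ℕ), ∀ n : ℕ, n₀ ≤ n →
      ∃ (G : CapGraph (Fin n)) (T : Finset (Fin n)),
        G.graph.Connected ∧
        T.card = ⌊(n : ℝ) / (2 : ℝ) ^ ((Real.logb 2 n) ^ α)⌋₊ ∧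
        ∀ C : ℝ, N C ≤ n →
          ∀ F : Finpartition (Finset.univ : Finset (Fin n)), ValidPartition T F →
            (F.parts.card : ℝ) ≤ C * ((n : ℝ) / (2 : ℝ) ^ ((Real.logb 2 n) ^ β)) →
              ∃ D : Demand T,
                ENNReal.ofReal (c * (Real.logb 2 n) ^ (1 - α)) ≤
                  G.cong (fun t : T => (t : Fin n)) D ∧
                (G.contract F).cong (fun t : T => clusterOf F (t : Fin n)) D ≤ 3 := by
  obtain ⟨hα0, hα1, hαβ⟩ := exponent_bounds hε0 hε1 hα hβ
  obtain ⟨c, hc, n₀, N, h⟩ := theorem3p1_general hα0 hα1 hαβ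
  exact ⟨c, hc, n₀, N, fun n hn =>
    let ⟨G, T, hG, hT, hD⟩ := h n hn
    ⟨G, T, hG, hT, fun C hC F _ => hD C hC F⟩⟩
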